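/- Let $X\subseteq\mathbb{R}^n$, $Y\subseteq\mathbb{R}^m$ ($n,m\ge 1$) be closed convex sets, $Z=X\times Y$, and consider $\min_{x\in X}\max_{y\in Y}f(x,y)$. Let $X_1,Y_1$ be the closed $1$-neighbourhoods of $X,Y$. Assume: for $y\in Y$, $f(\cdot,y)$ is $\mu$-strongly convex on $X$ and is differentiable on $X_1$ with $L_x$-Lipschitz gradient; for $x\in X$, $f(x,\cdot)$ is $\mu$-strongly concave on $Y$ and is differentiable on $Y_1$ with $L_y$-Lipschitz gradient; on $X\times Y$, $\nabla_xf$ is $L_{xy}$-Lipschitz in $y$, $\nabla_yf$ is $L_{xy}$-Lipschitz in $x$, and $\|\nabla_xf\|,\|\nabla_yf\|\le M$. Put $L=2\max(L_x,L_y,L_{xy})$, assume $0<\mu\le L$, and let $\kappa=L/\mu$. Let $F(z)=(\nabla_xf(x,y),-\nabla_yf(x,y))$ for $z=(x,y)$, and let $z^*\in Z$ satisfy $F(z^*)^\top(z-z^*)\ge 0$ for all $z\in Z$. A stochastic oracle returns values $\hat f(x,y,\xi)$, jointly measurable in $(x,y,\xi)$, where $\xi\sim P$. On $(X_1\times Y)\cup(X\times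 Y_1)$ one has $\mathbb{E}\hat f(x,y,\xi)=f(x,y)$. For every $\xi$, $\hat f(\cdot,y,\xi)$ is differentiable on $X_1$ for $y\in Y$, and on $X_1\times Y$ one has $\mathbb{E}\nabla_x\hat f(x,y,\xi)=\nabla_xf(x,y)$ and $\mathbb{E}\|\nabla_x\hat f(x,y,\xi)-\nabla_xf(x,y)\|^2\le\sigma^2$; likewise for $\hat f(x,\cdot,\xi)$ and $\nabla_y$ on $X\times Y_1$. For smoothing radii $\rho_x,\rho_y>0$ and unit vectors $u\in\mathbb{R}^n$, $v\in\mathbb{R}^m$ let $$\hat F_\rho(z,u,v,\xi)=\begin{pmatrix}\frac{n}{\rho_x}\big(\hat f(x+\rho_xu,y,\xi)-\hat f(x,y,\xi)\big)u\\[2pt]-\frac{m}{\rho_y}\big(\hat f(x,y+\rho_yv,\xi)-\hat f(x,y,\xi)\big)v\end{pmatrix},\qquad \hat F^k_\rho(z)=\frac1{t_k}\sum_{i=1}^{t_k}\hat F_\rho(z,u^k_{(i)},v^k_{(i)},\xi^k_{(i)}),$$ where all the $\xi^k_{(i)}\sim P$ and all the $u^k_{(i)}$, $v^k_{(i)}$,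 uniform on the unit spheres, are independent. For a planned iteration count $K$, the stochastic zeroth-order extra-momentum method starts at a deterministic $z^0\in Z$ and iterates $$z^{k+1}=P_Z\Big(z^k-\alpha\hat F^k_\rho(z^k)+\gamma(z^k-z^{k-1})-\tau\big(\hat F^k_\rho(z^k)-\hat F^{k-1}_\rho(z^{k-1})\big)\Big),\qquad k=0,1,\dots,$$ with $P_Z$ the Euclidean projection onto $Z$, with the convention $z^{-1}=z^0$, $\hat F^{-1}_\rho(z^{-1})=\hat F^0_\rho(z^0)$ (both momentum terms vanish for $k=0$), and with $$\alpha=\frac1{4L},\quad \tau=\frac{\alpha}{1+\theta/\kappa},\quad \gamma=\frac1{8(\kappa+\theta)},\quad \theta=\frac18,\qquad t_k=\Big\lceil K\big(1-\tfrac1{8\kappa+1}\big)^{-k}\Big\rceil,$$ $$\rho_x=\frac1{\sqrt2\,n\kappa}\Big(1-\frac1{8\kappa+1}\Big)^{K/2},\qquad \rho_y=\frac1{\sqrt2\,m\kappa}\Big(1-\frac1{8\kappa+1}\Big)^{K/2}.$$ Then for all $n,m,L_x,L_y,L_{xy},M,\sigma,R$ there is a constant $A>0$, depending only on these numbers, such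 that for every $\mu\in(0,L]$ and every $\varepsilon\in(0,1/2]$ there is an iteration count $K\ge1$ with $$K\le A\,\kappa\ln\frac1\varepsilon,\qquad \sum_{k=0}^{K-1}t_k\le A\,\frac{\kappa^2}{\varepsilon}\ln\frac1\varepsilon,$$ such that, for every problem, oracle and starting point as above with $\|z^0-z^*\|\le R$, the method run with this $K$ outputs $z^K$ with $\mathbb{E}\|z^K-z^*\|^2\le\varepsilon$. -/

import Mathlib

open MeasureTheory ProbabilityTheory

noncomputable section

namespace SZO

/-- The Euclidean space of the joint variable `z = (x, y)`, with
`‖(x, y)‖² = ‖x‖² + ‖y‖²`. -/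
abbrev Joint (n m : ℕ) : Type :=
  WithLp 2 (EuclideanSpace ℝ (Fin n) × EuclideanSpace ℝ (Fin m))

variable {n m : ℕ}

/-- The feasible set `Z = X × Y`. -/
def feasible (X : Set (EuclideanSpace ℝ (Fin n))) (Y : Set (EuclideanSpace ℝ (Fin m))) :
    Set (Joint n m) :=
  {z | z.fst ∈ X ∧ z.snd ∈ Y}

/-- The partial gradient of `f` in the first variable, the second one being fixed. -/
def gradX (f : EuclideanSpace ℝ (Fin n) → EuclideanSpace ℝ (Fin m) → ℝ)
    (x : EuclideanSpace ℝ (Fin n)) (y : EuclideanSpace ℝ (Fin m)) : EuclideanSpace ℝ (Fin n) :=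
  gradient (fun x' => f x' y) x

/-- The partial gradient of `f` in the second variable, the first one being fixed. -/
def gradY (f : EuclideanSpace ℝ (Fin n) → EuclideanSpace ℝ (Fin m) → ℝ)
    (x : EuclideanSpace ℝ (Fin n)) (y : EuclideanSpace ℝ (Fin m)) : EuclideanSpace ℝ (Fin m) :=
  gradient (fun y' => f x y') y

/-- The mapping `F(z) = (∇ₓ f(x, y), -∇_y f(x, y))`. -/
def saddleMap (f : EuclideanSpace ℝ (Fin n) → EuclideanSpace ℝ (Fin m) → ℝ) (z : Joint n m) :
    Joint n m :=
  WithLp.toLp 2 (gradX f z.fst z.snd, -gradY f z.fst z.snd)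

/-- `zs` solves the variational inequality of `F` over `S`. -/
def IsVISolution {H : Type*} [NormedAddCommGroup H] [InnerProductSpace ℝ H]
    (S : Set H) (F : H → H) (zs : H) : Prop :=
  zs ∈ S ∧ ∀ z ∈ S, 0 ≤ inner ℝ (F zs) (z - zs)

/-- The assumptions on the saddle-point problem `min_{x ∈ X} max_{y ∈ Y} f(x, y)`.
The smoothing evaluates `f` slightly outside of `X × Y`; all smoothing radii used below are
smaller than `1`, so regularity in one variable is asked on the closed `1`-neighbourhood of its
feasible set, the other variable being feasible. -/
structure IsSaddleProblem (X : Set (EuclideanSpace ℝ (Fin n)))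
    (Y : Set (EuclideanSpace ℝ (Fin m)))
    (f : EuclideanSpace ℝ (Fin n) → EuclideanSpace ℝ (Fin m) → ℝ)
    (μ Lx Ly Lxy M : ℝ) : Prop where
  closed_X : IsClosed X
  closed_Y : IsClosed Y
  convex_X : Convex ℝ X
  convex_Y : Convex ℝ Y
  differentiable_x : ∀ x ∈ Metric.cthickening 1 X, ∀ y ∈ Y,
    DifferentiableAt ℝ (fun x' => f x' y) x
  differentiable_y : ∀ x ∈ X, ∀ y ∈ Metric.cthickening 1 Y,
    DifferentiableAt ℝ (fun y' => f x y') y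
  strongConvex : ∀ y ∈ Y, StrongConvexOn X μ (fun x => f x y)
  strongConcave : ∀ x ∈ X, StrongConcaveOn Y μ (fun y => f x y)
  lipschitz_xx : ∀ y ∈ Y, ∀ x ∈ Metric.cthickening 1 X, ∀ x' ∈ Metric.cthickening 1 X,
    ‖gradX f x y - gradX f x' y‖ ≤ Lx * ‖x - x'‖
  lipschitz_yy : ∀ x ∈ X, ∀ y ∈ Metric.cthickening 1 Y, ∀ y' ∈ Metric.cthickening 1 Y,
    ‖gradY f x y - gradY f x y'‖ ≤ Ly * ‖y - y'‖
  lipschitz_xy : ∀ x ∈ X, ∀ y ∈ Y, ∀ y' ∈ Y, ‖gradX f x y - gradX f x y'‖ ≤ Lxy * ‖y - y'‖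
  lipschitz_yx : ∀ y ∈ Y, ∀ x ∈ X, ∀ x' ∈ X, ‖gradY f x y - gradY f x' y‖ ≤ Lxy * ‖x - x'‖
  bound_x : ∀ x ∈ X, ∀ y ∈ Y, ‖gradX f x y‖ ≤ M
  bound_y : ∀ x ∈ X, ∀ y ∈ Y, ‖gradY f x y‖ ≤ M

/-- The assumptions on the stochastic oracle: for `ξ` with law `P`, the noisy value
`fhat x y ξ` and its partial gradients are unbiased, and the partial gradients have variance at
most `σ²`. They are asked at the points where the method can query the oracle. -/
structure IsOracle {Ξ : Type*} [MeasurableSpace Ξ] (P : Measure Ξ)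
    (X : Set (EuclideanSpace ℝ (Fin n))) (Y : Set (EuclideanSpace ℝ (Fin m)))
    (f : EuclideanSpace ℝ (Fin n) → EuclideanSpace ℝ (Fin m) → ℝ)
    (fhat : EuclideanSpace ℝ (Fin n) → EuclideanSpace ℝ (Fin m) → Ξ → ℝ) (σ : ℝ) : Prop where
  measurable : Measurable
    (fun p : (EuclideanSpace ℝ (Fin n) × EuclideanSpace ℝ (Fin m)) × Ξ => fhat p.1.1 p.1.2 p.2)
  differentiable_x : ∀ ξ, ∀ x ∈ Metric.cthickening 1 X, ∀ y ∈ Y,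
    DifferentiableAt ℝ (fun x' => fhat x' y ξ) x
  differentiable_y : ∀ ξ, ∀ x ∈ X, ∀ y ∈ Metric.cthickening 1 Y,
    DifferentiableAt ℝ (fun y' => fhat x y' ξ) y
  mean_x : ∀ x ∈ Metric.cthickening 1 X, ∀ y ∈ Y,
    Integrable (fun ξ => fhat x y ξ) P ∧ ∫ ξ, fhat x y ξ ∂P = f x y
  mean_y : ∀ x ∈ X, ∀ y ∈ Metric.cthickening 1 Y,
    Integrable (fun ξ => fhat x y ξ) P ∧ ∫ ξ, fhat x y ξ ∂P = f x y
  mean_gradX : ∀ x ∈ Metric.cthickening 1 X, ∀ y ∈ Y,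
    Integrable (fun ξ => gradX (fun x' y' => fhat x' y' ξ) x y) P ∧
      ∫ ξ, gradX (fun x' y' => fhat x' y' ξ) x y ∂P = gradX f x y
  mean_gradY : ∀ x ∈ X, ∀ y ∈ Metric.cthickening 1 Y,
    Integrable (fun ξ => gradY (fun x' y' => fhat x' y' ξ) x y) P ∧
      ∫ ξ, gradY (fun x' y' => fhat x' y' ξ) x y ∂P = gradY f x y
  variance_gradX : ∀ x ∈ Metric.cthickening 1 X, ∀ y ∈ Y,
    Integrable (fun ξ => ‖gradX (fun x' y' => fhat x' y' ξ) x y - gradX f x y‖ ^ 2) P ∧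
      ∫ ξ, ‖gradX (fun x' y' => fhat x' y' ξ) x y - gradX f x y‖ ^ 2 ∂P ≤ σ ^ 2
  variance_gradY : ∀ x ∈ X, ∀ y ∈ Metric.cthickening 1 Y,
    Integrable (fun ξ => ‖gradY (fun x' y' => fhat x' y' ξ) x y - gradY f x y‖ ^ 2) P ∧
      ∫ ξ, ‖gradY (fun x' y' => fhat x' y' ξ) x y - gradY f x y‖ ^ 2 ∂P ≤ σ ^ 2

/-- The uniform probability distribution on the Euclidean unit sphere of `ℝⁿ` (for `n ≥ 1`):
the normalized surface measure, as a measure on `ℝⁿ`. -/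
def sphereUniform (n : ℕ) : Measure (EuclideanSpace ℝ (Fin n)) :=
  let S : Measure (Metric.sphere (0 : EuclideanSpace ℝ (Fin n)) 1) :=
    (volume : Measure (EuclideanSpace ℝ (Fin n))).toSphere
  ((S Set.univ)⁻¹ • S).map Subtype.val

/-- The type of one sample `(ξ, u, v)`. -/
abbrev Sample (Ξ : Type*) (n m : ℕ) : Type _ :=
  Ξ × EuclideanSpace ℝ (Fin n) × EuclideanSpace ℝ (Fin m)

/-- The samples `w k i = (ξ, u, v)` (iteration `k`, index `i` in its batch) are i.i.d.; in each
of them `ξ` has law `P`, `u` and `v` are uniform on the unit spheres, and the three are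
independent. -/
structure IsSampling {Ξ Ω : Type*} [MeasurableSpace Ξ] [MeasurableSpace Ω]
    (P : Measure Ξ) (Pr : Measure Ω) (w : ℕ → ℕ → Ω → Sample Ξ n m) : Prop where
  measurable : ∀ k i, Measurable (w k i)
  law : ∀ k i, Pr.map (w k i) = P.prod ((sphereUniform n).prod (sphereUniform m))
  indep : iIndepFun (fun (p : ℕ × ℕ) => w p.1 p.2) Pr

/-- The stochastic zeroth-order gradient, built from one sample `(ξ, u, v)`. -/
def szGrad {Ξ : Type*}
    (fhat : EuclideanSpace ℝ (Fin n) → EuclideanSpace ℝ (Fin m) → Ξ → ℝ) (ρx ρy : ℝ)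
    (z : Joint n m) : Sample Ξ n m → Joint n m
  | (ξ, u, v) => WithLp.toLp 2
      ((n / ρx * (fhat (z.fst + ρx • u) z.snd ξ - fhat z.fst z.snd ξ)) • u,
        -((m / ρy * (fhat z.fst (z.snd + ρy • v) ξ - fhat z.fst z.snd ξ)) • v))

/-- The average of `t` stochastic zeroth-order gradients at `z`. -/
def batchGrad {Ξ : Type*}
    (fhat : EuclideanSpace ℝ (Fin n) → EuclideanSpace ℝ (Fin m) → Ξ → ℝ) (ρx ρy : ℝ)
    (t : ℕ) (s : ℕ → Sample Ξ n m) (z : Joint n m) : Joint n m :=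
  (1 / (t : ℝ)) • ∑ i ∈ Finset.range t, szGrad fhat ρx ρy z (s i)

/-- The projection of `p` onto `S`: the nearest point of `S`
(it exists and is unique if `S` is non-empty, closed and convex). -/
def proj {H : Type*} [NormedAddCommGroup H] (S : Set H) (p : H) : H :=
  Classical.epsilon fun q => q ∈ S ∧ ∀ w ∈ S, ‖p - q‖ ≤ ‖p - w‖

/-- One extra-momentum step from the current point `z` and the previous point `zp`, with the
directions `g` and `gp` computed at them. -/
def momentumStep {H : Type*} [NormedAddCommGroup H] [NormedSpace ℝ H] (S : Set H)
    (α γ τ : ℝ) (z zp g gp : H) : H :=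
  proj S (z - α • g + γ • (z - zp) - τ • (g - gp))

/-- The extra-momentum iteration, where `G k` gives the direction used at iteration `k`.
It is started with `z⁻¹ = z⁰`, so that both momentum terms vanish in the first step. -/
def momentumIter {H : Type*} [NormedAddCommGroup H] [NormedSpace ℝ H] (S : Set H)
    (α γ τ : ℝ) (G : ℕ → H → H) (z0 : H) : ℕ → H
  | 0 => z0
  | 1 => momentumStep S α γ τ z0 z0 (G 0 z0) (G 0 z0)
  | k + 2 =>
      momentumStep S α γ τ (momentumIter S α γ τ G z0 (k + 1)) (momentumIter S α γ τ G z0 k)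
        (G (k + 1) (momentumIter S α γ τ G z0 (k + 1))) (G k (momentumIter S α γ τ G z0 k))

/-- The contraction factor `1 - 1 / (8κ + 1)`. -/
def rate (κ : ℝ) : ℝ := 1 - 1 / (8 * κ + 1)

/-- The batch size `t_k = ⌈K (1 - 1 / (8κ + 1))^(-k)⌉`. -/
def batchSize (κ : ℝ) (K k : ℕ) : ℕ := ⌈(K : ℝ) * rate κ ^ (-(k : ℤ))⌉₊

/-- The smoothing radius `(1 - 1 / (8κ + 1))^(K / 2) / (√2 d κ)` in dimension `d`. -/
def radius (κ : ℝ) (K d : ℕ) : ℝ := 1 / (√2 * d * κ) * rate κ ^ ((K : ℝ) / 2)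

/-- The step size `α = 1 / (4L)`. -/
def stepα (L : ℝ) : ℝ := 1 / (4 * L)

/-- The optimism parameter `τ = α / (1 + θ / κ)` with `θ = 1 / 8`. -/
def stepτ (L κ : ℝ) : ℝ := stepα L / (1 + (1 / 8) / κ)

/-- The heavy-ball parameter `γ = 1 / (8 (κ + θ))` with `θ = 1 / 8`. -/
def stepγ (κ : ℝ) : ℝ := 1 / (8 * (κ + 1 / 8))

/-- The iterate `z^k` of the stochastic zeroth-order extra-momentum method that is run with the
planned iteration count `K`, on the realization `s` of the samples. -/
def szoExm {Ξ : Type*} (X : Set (EuclideanSpace ℝ (Fin n)))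
    (Y : Set (EuclideanSpace ℝ (Fin m)))
    (fhat : EuclideanSpace ℝ (Fin n) → EuclideanSpace ℝ (Fin m) → Ξ → ℝ)
    (L κ : ℝ) (K : ℕ) (s : ℕ → ℕ → Sample Ξ n m) (z0 : Joint n m) (k : ℕ) : Joint n m :=
  momentumIter (feasible X Y) (stepα L) (stepγ κ) (stepτ L κ)
    (fun j z => batchGrad fhat (radius κ K n) (radius κ K m) (batchSize κ K j) (s j) z) z0 k

end SZO

end

/-!
Linear convergence of the extra-momentum method, when the noise and the bias of its directions are
of the order of the accuracy reached so far.

Write `q = rate κ`, `d_k = z^k - z*`, `F_k = F(z^k)`. The method contracts the potential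
`½ (1 + 1/(8κ)) ‖d_k‖² - α ⟪F_k - F_{k-1}, d_k⟫ + (5/16) ‖z^k - z^{k-1}‖²`, which dominates
`‖d_k‖² / 4`, by the factor `q` in each step (`potential_step`). This follows from the variational
inequality that characterizes the projection, tested at `z*`, and from strong monotonicity: since
`τ = α q`, the extrapolation term telescopes at rate exactly `q`, and `κ (1/q - 1) = 1/8` leaves
room in the strong monotonicity term for the momentum and the bias.

A direction is `F_k` plus noise plus bias. The iterate `z^k` depends on earlier samples only, so
the noise is orthogonal to `d_k` in mean, and what remains of it is its second moment, at most
`V / t_k ≤ V q ^ k / K`: the `K` contributions of size `q ^ k / K` add up to `q ^ K`. The bias is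
at most `B` with `κ² B² = O(q ^ K)`, and its contribution `κ B² / (1 - q)` is again `O(q ^ K)`.
This gives `𝔼 ‖d_K‖² ≤ C q ^ K` (`integral_norm_samplePath_sub_sq_le`) with `C` independent of `κ`
and `ε`, and `K` is the least integer with `C q ^ K ≤ ε`.

For the zeroth-order oracle (`isSampledVI_szGrad`), the bias comes from the mean value inequality
and the covariance `𝔼[u uᵀ] = I / n` of the sphere, itself a consequence of invariance under
reflections. The second moment comes from writing an increment of the noisy function as the
integral of its derivative along a segment.
-/

noncomputable section

namespace SZO

/-! ### Projection onto a closed convex set, and the recursion -/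

section Projection

variable {H : Type*} [NormedAddCommGroup H] [InnerProductSpace ℝ H] [CompleteSpace H] {S : Set H}

lemma proj_isNearest (hc : IsClosed S) (hconv : Convex ℝ S) (hne : S.Nonempty) (p : H) :
    proj S p ∈ S ∧ ∀ w ∈ S, ‖p - proj S p‖ ≤ ‖p - w‖ := by
  obtain ⟨q, hq, hmin⟩ := exists_norm_eq_iInf_of_complete_convex hne hc.isComplete hconv p
  refine Classical.epsilon_spec (p := fun q => q ∈ S ∧ ∀ w ∈ S, ‖p - q‖ ≤ ‖p - w‖) ⟨q, hq, ?_⟩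
  intro w hw
  rw [hmin]
  exact ciInf_le ⟨0, by rintro _ ⟨w, rfl⟩; exact norm_nonneg _⟩ (⟨w, hw⟩ : S)

lemma proj_mem (hc : IsClosed S) (hconv : Convex ℝ S) (hne : S.Nonempty) (p : H) :
    proj S p ∈ S := (proj_isNearest hc hconv hne p).1

lemma inner_sub_proj_nonpos (hc : IsClosed S) (hconv : Convex ℝ S) (hne : S.Nonempty) (p : H)
    {w : H} (hw : w ∈ S) : inner ℝ (p - proj S p) (w - proj S p) ≤ 0 := by
  obtain ⟨hmem, hmin⟩ := proj_isNearest hc hconv hne p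
  refine (norm_eq_iInf_iff_real_inner_le_zero hconv hmem).1 (le_antisymm ?_ ?_) w hw
  · have : Nonempty S := hne.to_subtype
    exact le_ciInf fun w => hmin w w.2
  · exact ciInf_le ⟨0, by rintro _ ⟨w, rfl⟩; exact norm_nonneg _⟩ (⟨_, hmem⟩ : S)

lemma proj_eq_self (hc : IsClosed S) (hconv : Convex ℝ S) {p : H} (hp : p ∈ S) :
    proj S p = p := by
  have h := (proj_isNearest hc hconv ⟨p, hp⟩ p).2 p hp
  rw [sub_self, norm_zero, norm_le_zero_iff, sub_eq_zero] at h
  exact h.symm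

lemma norm_proj_sub_proj_le (hc : IsClosed S) (hconv : Convex ℝ S) (hne : S.Nonempty) (p p' : H) :
    ‖proj S p - proj S p'‖ ≤ ‖p - p'‖ := by
  have h1 := inner_sub_proj_nonpos hc hconv hne p (proj_mem hc hconv hne p')
  have h2 := inner_sub_proj_nonpos hc hconv hne p' (proj_mem hc hconv hne p)
  set a := proj S p
  set b := proj S p'
  have h3 : inner ℝ (a - b) (a - b) ≤ inner ℝ (p - p') (a - b) := by
    simp only [inner_sub_left, inner_sub_right] at h1 h2 ⊢
    linarith
  have h4 := real_inner_le_norm (p - p') (a - b)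
  rw [real_inner_self_eq_norm_sq] at h3
  by_contra! h
  have : 0 < ‖a - b‖ := (norm_nonneg _).trans_lt h
  nlinarith

lemma continuous_proj (hc : IsClosed S) (hconv : Convex ℝ S) (hne : S.Nonempty) :
    Continuous (proj S) :=
  (LipschitzWith.of_dist_le_mul (K := 1) fun p p' => by
    simpa [dist_eq_norm] using norm_proj_sub_proj_le hc hconv hne p p').continuous

end Projection

section Iteration

variable {H : Type*} [NormedAddCommGroup H] [NormedSpace ℝ H]

/-- The recursion of the method in one formula: with truncated subtraction the convention
`z⁻¹ = z⁰` becomes `k - 1 = 0` for `k = 0`. -/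
lemma momentumIter_succ (S : Set H) (α γ τ : ℝ) (G : ℕ → H → H) (z0 : H) (k : ℕ) :
    momentumIter S α γ τ G z0 (k + 1) =
      momentumStep S α γ τ (momentumIter S α γ τ G z0 k) (momentumIter S α γ τ G z0 (k - 1))
        (G k (momentumIter S α γ τ G z0 k)) (G (k - 1) (momentumIter S α γ τ G z0 (k - 1))) := by
  cases k <;> simp [momentumIter]

end Iteration

/-! ### The parameters of the method -/

section Rate

lemma rate_eq {κ : ℝ} (hκ : 1 ≤ κ) : rate κ = κ / (κ + 1 / 8) := by
  unfold rate; field_simp; ring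

lemma rate_pos {κ : ℝ} (hκ : 1 ≤ κ) : 0 < rate κ := by
  rw [rate_eq hκ]; positivity

lemma le_rate {κ : ℝ} (hκ : 1 ≤ κ) : 8 / 9 ≤ rate κ := by
  rw [rate_eq hκ, le_div_iff₀ (by positivity)]; linarith

lemma rate_lt_one {κ : ℝ} (hκ : 1 ≤ κ) : rate κ < 1 := by
  rw [rate_eq hκ, div_lt_one (by positivity)]; linarith

lemma stepτ_eq {κ : ℝ} (hκ : 1 ≤ κ) (L : ℝ) : stepτ L κ = stepα L * rate κ := by
  rw [rate_eq hκ, stepτ]; field_simp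

lemma stepγ_eq {κ : ℝ} (hκ : 1 ≤ κ) : stepγ κ = rate κ / (8 * κ) := by
  rw [rate_eq hκ, stepγ]; field_simp

end Rate

/-! ### The potential and its decrease in one step -/

section OneStep

variable {H : Type*} [NormedAddCommGroup H] [InnerProductSpace ℝ H]

/-- The potential of two successive points `zp`, `z` with operator values `Fp`, `F`. The inner
product makes up for the delay of the operator extrapolation `τ (F z - F zp)`, and the weight
`1 + 1 / (8κ)` is the inverse of `rate κ`. -/
def potential (α κ : ℝ) (zs z zp F Fp : H) : ℝ :=
  1 / 2 * (1 + 1 / (8 * κ)) * ‖z - zs‖ ^ 2 - α * inner ℝ (F - Fp) (z - zs) +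
    5 / 16 * ‖z - zp‖ ^ 2

/-- The potential controls the distance to the solution, although its second term may be
negative. -/
lemma quarter_norm_sq_le_potential {L κ : ℝ} (hL : 0 < L) (hκ : 1 ≤ κ) {zs z zp F Fp : H}
    (hF : ‖F - Fp‖ ≤ L * ‖z - zp‖) :
    1 / 4 * ‖z - zs‖ ^ 2 ≤ potential (stepα L) κ zs z zp F Fp := by
  have h1 : stepα L * inner ℝ (F - Fp) (z - zs) ≤ 1 / 4 * ‖z - zp‖ * ‖z - zs‖ := by
    calc stepα L * inner ℝ (F - Fp) (z - zs)
        ≤ stepα L * ((L * ‖z - zp‖) * ‖z - zs‖) := by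
          have : 0 < stepα L := by unfold stepα; positivity
          gcongr
          exact (real_inner_le_norm _ _).trans (by gcongr)
      _ = 1 / 4 * ‖z - zp‖ * ‖z - zs‖ := by unfold stepα; field_simp
  have h2 : 0 ≤ 1 / (8 * κ) * ‖z - zs‖ ^ 2 := by positivity
  unfold potential
  nlinarith [sq_nonneg (‖z - zp‖ - ‖z - zs‖), sq_nonneg ‖z - zs‖, sq_nonneg ‖z - zp‖]

/-- Young's inequality for a scaled inner product. -/
lemma mul_inner_le_add (c : ℝ) {δ : ℝ} (hδ : 0 < δ) (x y : H) :
    c * inner ℝ x y ≤ δ * ‖y‖ ^ 2 + c ^ 2 / (4 * δ) * ‖x‖ ^ 2 := by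
  have h1 : c * inner ℝ x y ≤ |c| * (‖x‖ * ‖y‖) := by
    rw [← abs_of_nonneg (by positivity : 0 ≤ ‖x‖ * ‖y‖), ← abs_mul]
    refine (le_abs_self _).trans ?_
    rw [abs_mul, abs_mul, abs_of_nonneg (by positivity : 0 ≤ ‖x‖ * ‖y‖)]
    gcongr
    exact abs_real_inner_le_norm x y
  have h2 : 0 ≤ δ * (‖y‖ - |c| * ‖x‖ / (2 * δ)) ^ 2 := by positivity
  have h3 : δ * (‖y‖ - |c| * ‖x‖ / (2 * δ)) ^ 2 =
      δ * ‖y‖ ^ 2 + |c| ^ 2 / (4 * δ) * ‖x‖ ^ 2 - |c| * (‖x‖ * ‖y‖) := by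
    field_simp; ring
  rw [sq_abs] at h3
  linarith

/-- One step of the method with inexact directions. The direction at `z` is `F + e + b`, where
`e` is the noise, to be cancelled in expectation through the two inner products at the end,
and `b` is a bias of norm at most `B`. Strong monotonicity provides the term
`(1 / (4κ)) ‖z' - zs‖²`, which pays for the contraction, for the heavy-ball momentum and for the
bias. -/
lemma potential_step {L κ B : ℝ} (hL : 0 < L) (hκ : 1 ≤ κ)
    {zs z' z zp F' F Fp e ep b bp : H}
    (hproj : inner ℝ (z - stepα L • (F + e + b) + stepγ κ • (z - zp)
      - stepτ L κ • (F + e + b - (Fp + ep + bp)) - z') (zs - z') ≤ 0)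
    (hmono : L / κ * ‖z' - zs‖ ^ 2 ≤ inner ℝ F' (z' - zs))
    (hlip : ‖F - Fp‖ ≤ L * ‖z - zp‖) (hb : ‖b‖ ≤ B) (hbp : ‖bp‖ ≤ B) :
    potential (stepα L) κ zs z' z F' F ≤ rate κ * potential (stepα L) κ zs z zp F Fp
      + (32 * stepα L ^ 2 * ‖e‖ ^ 2 + 16 * stepα L ^ 2 * ‖ep‖ ^ 2 + 18 * κ * stepα L ^ 2 * B ^ 2)
      - (stepα L + stepτ L κ) * inner ℝ e (z - zs) + stepτ L κ * inner ℝ ep (zp - zs) := by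
  have hq := rate_pos hκ
  have hq' := rate_lt_one hκ
  have hq8 := le_rate hκ
  have hα : 0 < stepα L := by unfold stepα; positivity
  have hαL : stepα L * L = 1 / 4 := by unfold stepα; field_simp
  have hτ := stepτ_eq hκ L
  have hγ := stepγ_eq hκ
  have hqκ : rate κ * (1 + 1 / (8 * κ)) = 1 := by rw [rate_eq hκ]; field_simp
  have hB : 0 ≤ B := (norm_nonneg b).trans hb
  set α := stepα L
  set q := rate κ
  set τ := stepτ L κ
  set γ := stepγ κ
  have hγ0 : 0 < γ := by rw [hγ]; positivity
  have hτ0 : 0 < τ := by rw [hτ]; positivity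
  have hτα : τ ≤ α := by rw [hτ]; nlinarith
  -- the displacement from the solution and the two successive steps
  obtain ⟨d, hd⟩ : ∃ d, d = z' - zs := ⟨_, rfl⟩
  obtain ⟨s, hs⟩ : ∃ s, s = z' - z := ⟨_, rfl⟩
  obtain ⟨r, hr⟩ : ∃ r, r = z - zp := ⟨_, rfl⟩
  have e1 : z - zs = d - s := by rw [hd, hs]; abel
  have e2 : zp - zs = d - s - r := by rw [hd, hs, hr]; abel
  have e3 : zs - z' = -d := by rw [hd]; abel
  -- the variational inequality of the projection, tested at the solution
  have hproj' : inner ℝ s d + α * inner ℝ F' d ≤ α * inner ℝ (F' - F) d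
      - τ * inner ℝ (F - Fp) (d - s) - τ * inner ℝ (F - Fp) s + γ * inner ℝ r d
      - (α + τ) * inner ℝ e d + τ * inner ℝ ep d - (α + τ) * inner ℝ b d + τ * inner ℝ bp d := by
    have e4 : z - α • (F + e + b) + γ • r - τ • (F + e + b - (Fp + ep + bp)) - z' =
      γ • r - s - α • (F + e + b) - τ • (F + e + b - (Fp + ep + bp)) := by rw [hs]; abel
    rw [← hr, e3, e4] at hproj
    simp only [inner_add_left, inner_sub_left, inner_smul_left, inner_neg_right, inner_sub_right,
      conj_trivial] at hproj ⊢
    linarith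
  have hsd : inner ℝ s d = 1 / 2 * (‖d‖ ^ 2 + ‖s‖ ^ 2 - ‖d - s‖ ^ 2) := by
    rw [norm_sub_sq_real, real_inner_comm]; ring
  rw [← hd] at hmono
  rw [← hr] at hlip
  unfold potential
  rw [← hd, ← hs, ← hr, e1, e2]
  -- the operator term and the momentum term
  have tF : -τ * inner ℝ (F - Fp) s ≤ 1 / 8 * ‖r‖ ^ 2 + 1 / 8 * ‖s‖ ^ 2 := by
    have h1 := mul_inner_le_add (-τ) (by norm_num : (0 : ℝ) < 1 / 8) (F - Fp) s
    have h2 : (-τ) ^ 2 / (4 * (1 / 8)) * ‖F - Fp‖ ^ 2 ≤ α ^ 2 / (4 * (1 / 8)) * (L * ‖r‖) ^ 2 := by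
      rw [neg_sq]; gcongr
    have h3 : α ^ 2 / (4 * (1 / 8)) * (L * ‖r‖) ^ 2 = 1 / 8 * ‖r‖ ^ 2 := by
      linear_combination (2 * ‖r‖ ^ 2 * (α * L + 1 / 4)) * hαL
    linarith
  have hγκ : γ ≤ 1 / (8 * κ) := by
    rw [hγ]; gcongr
  have tγ : γ * inner ℝ r d ≤ 1 / 2 * γ * ‖r‖ ^ 2 + 1 / (16 * κ) * ‖d‖ ^ 2 := by
    have h1 := mul_inner_le_add γ (by positivity : 0 < 1 / 2 * γ) r d
    have h2 : γ ^ 2 / (4 * (1 / 2 * γ)) = 1 / 2 * γ := by field_simp; norm_num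
    have h3 : 1 / 2 * γ * ‖d‖ ^ 2 ≤ 1 / (16 * κ) * ‖d‖ ^ 2 := by
      gcongr
      calc 1 / 2 * γ ≤ 1 / 2 * (1 / (8 * κ)) := by gcongr
        _ = 1 / (16 * κ) := by field_simp; norm_num
    rw [h2] at h1
    linarith
  have hγq : 1 / 2 * γ ≤ 1 / 16 * q := by
    rw [hγ, ← mul_div_assoc, div_le_iff₀ (by positivity)]
    nlinarith
  -- the noise
  have hτ2 : τ ^ 2 ≤ α ^ 2 := by gcongr
  have hατ2 : (α + τ) ^ 2 ≤ (2 * α) ^ 2 := by gcongr; linarith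
  have tn1 : -(α + τ) * inner ℝ e s ≤ 1 / 32 * ‖s‖ ^ 2 + 32 * α ^ 2 * ‖e‖ ^ 2 := by
    have h1 := mul_inner_le_add (-(α + τ)) (by norm_num : (0 : ℝ) < 1 / 32) e s
    have h2 : (-(α + τ)) ^ 2 / (4 * (1 / 32)) * ‖e‖ ^ 2 ≤ 32 * α ^ 2 * ‖e‖ ^ 2 := by
      gcongr
      rw [neg_sq, div_le_iff₀ (by norm_num)]
      linarith
    linarith
  have tn (v : H) : τ * inner ℝ ep v ≤ 1 / 32 * ‖v‖ ^ 2 + 8 * α ^ 2 * ‖ep‖ ^ 2 := by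
    have h1 := mul_inner_le_add τ (by norm_num : (0 : ℝ) < 1 / 32) ep v
    have h2 : τ ^ 2 / (4 * (1 / 32)) * ‖ep‖ ^ 2 ≤ 8 * α ^ 2 * ‖ep‖ ^ 2 := by
      gcongr
      rw [div_le_iff₀ (by norm_num)]
      linarith
    linarith
  -- the bias
  have tb : -(α + τ) * inner ℝ b d + τ * inner ℝ bp d ≤
      1 / (8 * κ) * ‖d‖ ^ 2 + 18 * κ * α ^ 2 * B ^ 2 := by
    have h1 := mul_inner_le_add 1 (by positivity : 0 < 1 / (8 * κ)) (-(α + τ) • b + τ • bp) d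
    rw [inner_add_left, inner_smul_left, inner_smul_left, one_mul] at h1
    have h2 : ‖-(α + τ) • b + τ • bp‖ ≤ 3 * α * B := by
      calc ‖-(α + τ) • b + τ • bp‖ ≤ (α + τ) * ‖b‖ + τ * ‖bp‖ := by
            refine (norm_add_le _ _).trans (le_of_eq ?_)
            rw [norm_smul, norm_smul, norm_neg, Real.norm_of_nonneg (by positivity),
              Real.norm_of_nonneg hτ0.le]
        _ ≤ (α + α) * B + α * B := by gcongr
        _ = 3 * α * B := by ring
    have h3 : 1 ^ 2 / (4 * (1 / (8 * κ))) * ‖-(α + τ) • b + τ • bp‖ ^ 2 ≤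
        1 ^ 2 / (4 * (1 / (8 * κ))) * (3 * α * B) ^ 2 := by gcongr
    have h4 : 1 ^ 2 / (4 * (1 / (8 * κ))) * (3 * α * B) ^ 2 = 18 * κ * α ^ 2 * B ^ 2 := by
      field_simp; ring
    simp only [conj_trivial] at h1
    linarith
  have tμ : 1 / (4 * κ) * ‖d‖ ^ 2 ≤ α * inner ℝ F' d := by
    calc 1 / (4 * κ) * ‖d‖ ^ 2 = α * (L / κ * ‖d‖ ^ 2) := by
          rw [show 1 / (4 * κ) = α * L / κ by rw [hαL]; field_simp]; ring
      _ ≤ α * inner ℝ F' d := by gcongr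
  have i1 : inner ℝ e d = inner ℝ e (d - s) + inner ℝ e s := by rw [inner_sub_right]; ring
  have i2 : inner ℝ ep d = inner ℝ ep (d - s - r) + inner ℝ ep s + inner ℝ ep r := by
    rw [inner_sub_right, inner_sub_right]; ring
  have tn2 := tn s
  have tn3 := tn r
  -- the exact budget of `‖d‖²`: strong monotonicity minus momentum minus bias
  have hκ1 : 1 / 2 * (1 + 1 / (8 * κ)) * ‖d‖ ^ 2 = 1 / 2 * ‖d‖ ^ 2 + 1 / (4 * κ) * ‖d‖ ^ 2
      - 1 / (16 * κ) * ‖d‖ ^ 2 - 1 / (8 * κ) * ‖d‖ ^ 2 := by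
    field_simp; ring
  have hκ2 : q * (1 / 2 * (1 + 1 / (8 * κ)) * ‖d - s‖ ^ 2 - α * inner ℝ (F - Fp) (d - s)
      + 5 / 16 * ‖r‖ ^ 2) = 1 / 2 * ‖d - s‖ ^ 2 - τ * inner ℝ (F - Fp) (d - s)
        + 5 / 16 * q * ‖r‖ ^ 2 := by
    rw [hτ]; linear_combination (1 / 2 * ‖d - s‖ ^ 2) * hqκ
  rw [hκ1, hκ2]
  rw [i1, i2, hsd] at hproj'
  have hr2 : (1 / 8 + 1 / 2 * γ + 1 / 32) * ‖r‖ ^ 2 ≤ 5 / 16 * q * ‖r‖ ^ 2 := by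
    gcongr; linarith
  linarith [sq_nonneg ‖r‖, sq_nonneg ‖s‖]

end OneStep

/-- A contraction with a geometrically decreasing and a constant perturbation. -/
lemma le_of_perturbed_contraction {q u v : ℝ} (hq : 0 < q) (hq1 : q < 1) {a : ℕ → ℝ}
    (h : ∀ k, a (k + 1) ≤ q * a k + u * q ^ k + v) (k : ℕ) :
    a k ≤ q ^ k * (a 0 + k * (u / q)) + v * (1 - q ^ k) / (1 - q) := by
  have h1 : (1 : ℝ) - q ≠ 0 := by linarith
  induction k with
  | zero => simp
  | succ k ih =>
    refine (h k).trans ?_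
    have := mul_le_mul_of_nonneg_left ih hq.le
    refine (add_le_add_left (add_le_add_left this _) _).trans (le_of_eq ?_)
    push_cast
    field_simp
    ring

/-! ### Averages of independent centred samples -/

section Independence

variable {𝒮 Ω X : Type*} [MeasurableSpace 𝒮] [MeasurableSpace Ω] [MeasurableSpace X]
  {Q : Measure 𝒮} {Pr : Measure Ω}

lemma integrable_inner_of_memLp {H : Type*} [NormedAddCommGroup H] [InnerProductSpace ℝ H]
    {f g : Ω → H} (hf : MemLp f 2 Pr) (hg : MemLp g 2 Pr) :
    Integrable (fun ω => inner ℝ (f ω) (g ω)) Pr := by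
  refine (hf.norm.integrable_mul hg.norm).mono' (hf.1.inner hg.1) (ae_of_all _ fun ω => ?_)
  simpa using abs_real_inner_le_norm (f ω) (g ω)

lemma integrable_norm_sq_of_memLp {H : Type*} [NormedAddCommGroup H] {f : Ω → H}
    (hf : MemLp f 2 Pr) : Integrable (fun ω => ‖f ω‖ ^ 2) Pr :=
  (memLp_two_iff_integrable_sq_norm hf.1).1 hf

lemma map_prodMk_eq [IsProbabilityMeasure Pr] {A : Ω → X} {W : Ω → 𝒮}
    (hA : Measurable A) (hW : Measurable W) (hlaw : Pr.map W = Q)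
    (hind : IndepFun A W Pr) : Pr.map (fun ω => (A ω, W ω)) = (Pr.map A).prod Q := by
  rw [(indepFun_iff_map_prod_eq_prod_map_map hA.aemeasurable hW.aemeasurable).1 hind, hlaw]

/-- A second moment bound that holds for each frozen `a` survives at an independent random
point `A`. -/
lemma memLp_comp_of_indepFun {H : Type*} [NormedAddCommGroup H] [MeasurableSpace H]
    [BorelSpace H] [SecondCountableTopology H] [IsProbabilityMeasure Q] [IsProbabilityMeasure Pr]
    {A : Ω → X} {W : Ω → 𝒮} {h : X → 𝒮 → H} (hA : Measurable A) (hW : Measurable W)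
    (hlaw : Pr.map W = Q) (hind : IndepFun A W Pr) (hm : Measurable (Function.uncurry h))
    (hL2 : ∀ a, MemLp (h a) 2 Q) {V : ℝ} (hV : ∀ a, ∫ s, ‖h a s‖ ^ 2 ∂Q ≤ V) :
    MemLp (fun ω => h (A ω) (W ω)) 2 Pr ∧ ∫ ω, ‖h (A ω) (W ω)‖ ^ 2 ∂Pr ≤ V := by
  have hAW : Measurable fun ω => (A ω, W ω) := hA.prodMk hW
  have := Measure.isProbabilityMeasure_map (μ := Pr) hA.aemeasurable
  have hφ : Measurable fun p : X × 𝒮 => ‖h p.1 p.2‖ ^ 2 := hm.norm.pow_const 2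
  have hΨ : AEStronglyMeasurable (fun a => ∫ s, ‖h a s‖ ^ 2 ∂Q) (Pr.map A) :=
    (hφ.stronglyMeasurable.integral_prod_right').aestronglyMeasurable
  have hΨ0 : ∀ a, 0 ≤ ∫ s, ‖h a s‖ ^ 2 ∂Q := fun a => integral_nonneg fun s => by positivity
  have hΨI : Integrable (fun a => ∫ s, ‖h a s‖ ^ 2 ∂Q) (Pr.map A) :=
    (integrable_const V).mono' hΨ (ae_of_all _ fun a => by
      rw [Real.norm_of_nonneg (hΨ0 a)]; exact hV a)
  have hI : Integrable (fun p : X × 𝒮 => ‖h p.1 p.2‖ ^ 2) ((Pr.map A).prod Q) := by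
    refine (integrable_prod_iff hφ.aestronglyMeasurable).2
      ⟨ae_of_all _ fun a => integrable_norm_sq_of_memLp (hL2 a), ?_⟩
    simpa using hΨI
  constructor
  · refine (memLp_two_iff_integrable_sq_norm (hm.comp hAW).aestronglyMeasurable).2 ?_
    rw [← map_prodMk_eq hA hW hlaw hind] at hI
    exact (integrable_map_measure hφ.aestronglyMeasurable hAW.aemeasurable).1 hI
  · calc ∫ ω, ‖h (A ω) (W ω)‖ ^ 2 ∂Pr
        = ∫ p, ‖h p.1 p.2‖ ^ 2 ∂(Pr.map fun ω => (A ω, W ω)) :=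
          (integral_map hAW.aemeasurable hφ.aestronglyMeasurable).symm
      _ = ∫ a, ∫ s, ‖h a s‖ ^ 2 ∂Q ∂(Pr.map A) := by
          rw [map_prodMk_eq hA hW hlaw hind, integral_prod _ hI]
      _ ≤ ∫ _, V ∂(Pr.map A) := integral_mono hΨI (integrable_const V) hV
      _ = V := by simp

variable {H : Type*} [NormedAddCommGroup H] [InnerProductSpace ℝ H]
  [MeasurableSpace H] [BorelSpace H] [SecondCountableTopology H]
  [IsProbabilityMeasure Q] [IsProbabilityMeasure Pr] {A : Ω → X} {W : Ω → 𝒮} {h : X → 𝒮 → H}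

/-- If `h a` is centred for each `a`, then `h(A, W)` is orthogonal to each function of `A`, when
`W` is independent of `A`. -/
lemma integral_inner_eq_zero_of_indepFun [CompleteSpace H] (hA : Measurable A) (hW : Measurable W)
    (hlaw : Pr.map W = Q) (hind : IndepFun A W Pr) (hm : Measurable (Function.uncurry h))
    (hint : ∀ a, Integrable (h a) Q) (h0 : ∀ a, ∫ s, h a s ∂Q = 0)
    {ψ : X → H} (hψ : Measurable ψ)
    (hI : Integrable (fun ω => inner ℝ (ψ (A ω)) (h (A ω) (W ω))) Pr) :
    ∫ ω, inner ℝ (ψ (A ω)) (h (A ω) (W ω)) ∂Pr = 0 := by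
  have hAW : Measurable fun ω => (A ω, W ω) := hA.prodMk hW
  have hφ : Measurable fun p : X × 𝒮 => inner ℝ (ψ p.1) (h p.1 p.2) :=
    (hψ.comp measurable_fst).inner hm
  have hI' : Integrable (fun p : X × 𝒮 => inner ℝ (ψ p.1) (h p.1 p.2)) ((Pr.map A).prod Q) := by
    rw [← map_prodMk_eq hA hW hlaw hind]
    exact (integrable_map_measure hφ.aestronglyMeasurable hAW.aemeasurable).2 hI
  have := Measure.isProbabilityMeasure_map (μ := Pr) hA.aemeasurable
  calc ∫ ω, inner ℝ (ψ (A ω)) (h (A ω) (W ω)) ∂Pr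
      = ∫ p, inner ℝ (ψ p.1) (h p.1 p.2) ∂(Pr.map fun ω => (A ω, W ω)) :=
        (integral_map hAW.aemeasurable hφ.aestronglyMeasurable).symm
    _ = ∫ a, ∫ s, inner ℝ (ψ a) (h a s) ∂Q ∂(Pr.map A) := by
        rw [map_prodMk_eq hA hW hlaw hind, integral_prod _ hI']
    _ = 0 := by
        simp [integral_inner (hint _), h0]

/-- The average of `t` evaluations of `g` at `z` with the samples `s 0, …, s (t - 1)`. -/
def sampleMean (g : X → 𝒮 → H) (t : ℕ) (s : ℕ → 𝒮) (x : X) : H :=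
  (1 / (t : ℝ)) • ∑ i ∈ Finset.range t, g x (s i)

/-- The mean of `t` centred samples, drawn at a random point `U` independent of them, is centred
given `U` and has second moment at most `V / t`. -/
lemma sampleMean_centred [CompleteSpace H] {U : Ω → X} {W : ℕ → Ω → 𝒮} (hU : Measurable U)
    (hW : ∀ i, Measurable (W i)) (hlaw : ∀ i, Pr.map (W i) = Q)
    (hind : ∀ i, IndepFun U (W i) Pr)
    (hpair : ∀ i j, i ≠ j → IndepFun (fun ω => (U ω, W i ω)) (W j) Pr)
    (hm : Measurable (Function.uncurry h)) (hL2 : ∀ a, MemLp (h a) 2 Q)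
    (h0 : ∀ a, ∫ s, h a s ∂Q = 0) {V : ℝ} (hV : ∀ a, ∫ s, ‖h a s‖ ^ 2 ∂Q ≤ V)
    {t : ℕ} (ht : 0 < t) :
    MemLp (fun ω => sampleMean h t (fun i => W i ω) (U ω)) 2 Pr ∧
    ∫ ω, ‖sampleMean h t (fun i => W i ω) (U ω)‖ ^ 2 ∂Pr ≤ V / t ∧
    ∀ ψ : X → H, Measurable ψ → MemLp (fun ω => ψ (U ω)) 2 Pr →
      ∫ ω, inner ℝ (sampleMean h t (fun i => W i ω) (U ω)) (ψ (U ω)) ∂Pr = 0 := by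
  have hmem i := memLp_comp_of_indepFun hU (hW i) (hlaw i) (hind i) hm hL2 hV
  have hint a : Integrable (h a) Q := (hL2 a).integrable (by norm_num)
  have hcross i j (hij : i ≠ j) :
      ∫ ω, inner ℝ (h (U ω) (W i ω)) (h (U ω) (W j ω)) ∂Pr = 0 :=
    integral_inner_eq_zero_of_indepFun (A := fun ω => (U ω, W i ω)) (W := W j)
      (h := fun p s => h p.1 s) (ψ := fun p => h p.1 p.2)
      (hU.prodMk (hW i)) (hW j) (hlaw j) (hpair i j hij)
      (hm.comp ((measurable_fst.comp measurable_fst).prodMk measurable_snd))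
      (fun p => hint p.1) (fun p => h0 p.1) hm
      (integrable_inner_of_memLp (hmem i).1 (hmem j).1)
  have ht' : (0 : ℝ) < t := by exact_mod_cast ht
  refine ⟨(memLp_finsetSum _ fun i _ => (hmem i).1).const_smul (1 / (t : ℝ)), ?_, ?_⟩
  · have e1 ω : ‖sampleMean h t (fun i => W i ω) (U ω)‖ ^ 2 = (1 / (t : ℝ)) ^ 2 *
        ∑ i ∈ Finset.range t, ∑ j ∈ Finset.range t,
          inner ℝ (h (U ω) (W i ω)) (h (U ω) (W j ω)) := by
      rw [sampleMean, norm_smul, mul_pow, ← real_inner_self_eq_norm_sq (∑ i ∈ _, _), sum_inner]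
      simp_rw [inner_sum]
      simp
    simp_rw [e1]
    rw [integral_const_mul, integral_finsetSum _ fun i _ => integrable_finsetSum _ fun j _ =>
      integrable_inner_of_memLp (hmem i).1 (hmem j).1]
    have e2 : ∀ i ∈ Finset.range t, ∫ ω, ∑ j ∈ Finset.range t,
        inner ℝ (h (U ω) (W i ω)) (h (U ω) (W j ω)) ∂Pr ≤ V := by
      intro i hi
      rw [integral_finsetSum _ fun j _ => integrable_inner_of_memLp (hmem i).1 (hmem j).1,
        Finset.sum_eq_single_of_mem i hi fun j _ hij => hcross i j hij.symm]
      simpa only [real_inner_self_eq_norm_sq] using (hmem i).2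
    calc (1 / (t : ℝ)) ^ 2 * ∑ i ∈ Finset.range t, ∫ ω, ∑ j ∈ Finset.range t,
          inner ℝ (h (U ω) (W i ω)) (h (U ω) (W j ω)) ∂Pr
        ≤ (1 / (t : ℝ)) ^ 2 * ∑ i ∈ Finset.range t, V := by
          gcongr with i hi; exact e2 i hi
      _ = V / t := by
          rw [Finset.sum_const, Finset.card_range, nsmul_eq_mul]; field_simp
  · intro ψ hψ hψ2
    simp_rw [sampleMean, inner_smul_left, sum_inner]
    rw [integral_const_mul, integral_finsetSum _ fun i _ =>
      integrable_inner_of_memLp (hmem i).1 hψ2, Finset.sum_eq_zero, mul_zero]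
    intro i _
    simp_rw [real_inner_comm (ψ _)]
    exact integral_inner_eq_zero_of_indepFun hU (hW i) (hlaw i) (hind i) hm hint h0 hψ
      (integrable_inner_of_memLp hψ2 (hmem i).1)

end Independence

lemma measurable_sampleMean {H 𝒮 Ω : Type*} [NormedAddCommGroup H] [InnerProductSpace ℝ H]
    [MeasurableSpace H] [BorelSpace H] [SecondCountableTopology H] [MeasurableSpace 𝒮]
    {g : H → 𝒮 → H} {m : MeasurableSpace Ω} {t : ℕ}
    (hg : Measurable (Function.uncurry g)) {W : ℕ → Ω → 𝒮} {U : Ω → H} (hU : Measurable U)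
    (hW : ∀ i, Measurable (W i)) :
    Measurable fun ω => sampleMean g t (fun i => W i ω) (U ω) := by
  unfold sampleMean
  refine (Finset.measurable_sum _ fun i _ => ?_).const_smul (1 / (t : ℝ))
  exact hg.comp (hU.prodMk (hW i))

/-! ### The past of the iteration -/

section History

variable {𝒮 Ω X : Type*} [MeasurableSpace 𝒮] {mΩ : MeasurableSpace Ω} [MeasurableSpace X]

/-- The σ-algebra generated by the samples `w k i` with index `(k, i)` in `T`. -/
abbrev sampleSigma (w : ℕ → ℕ → Ω → 𝒮) (T : Set (ℕ × ℕ)) : MeasurableSpace Ω :=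
  ⨆ p ∈ T, MeasurableSpace.comap (w p.1 p.2) inferInstance

lemma sampleSigma_mono (w : ℕ → ℕ → Ω → 𝒮) {T T' : Set (ℕ × ℕ)} (h : T ⊆ T') :
    sampleSigma w T ≤ sampleSigma w T' :=
  biSup_mono h

lemma sampleSigma_le {w : ℕ → ℕ → Ω → 𝒮} (hw : ∀ k i, Measurable (w k i)) (T : Set (ℕ × ℕ)) :
    sampleSigma w T ≤ mΩ :=
  iSup₂_le fun p _ => (hw p.1 p.2).comap_le

lemma measurable_sample (w : ℕ → ℕ → Ω → 𝒮) {T : Set (ℕ × ℕ)} {k i : ℕ} (h : (k, i) ∈ T) :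
    Measurable[sampleSigma w T] (w k i) := by
  have : MeasurableSpace.comap (w k i) inferInstance ≤ sampleSigma w T :=
    le_iSup₂_of_le (k, i) h le_rfl
  exact (comap_measurable (w k i)).mono this le_rfl

/-- A sample is independent of every function of other samples. -/
lemma indepFun_sample {Pr : Measure Ω} {w : ℕ → ℕ → Ω → 𝒮} (hw : ∀ k i, Measurable (w k i))
    (hind : iIndepFun (fun p : ℕ × ℕ => w p.1 p.2) Pr) {T : Set (ℕ × ℕ)} {k i : ℕ}
    (hT : (k, i) ∉ T) {A : Ω → X} (hA : Measurable[sampleSigma w T] A) :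
    IndepFun A (w k i) Pr := by
  have h1 := indep_iSup_of_disjoint (fun p : ℕ × ℕ => (hw p.1 p.2).comap_le) hind.iIndep
    (S := T) (T := {(k, i)}) (Set.disjoint_singleton_right.2 hT)
  rw [iSup_singleton] at h1
  exact (IndepFun_iff_Indep ..).2 (indep_of_indep_of_le_left h1 hA.comap_le)

end History

/-! ### Sampled variational inequalities -/

section SamplePath

variable {H 𝒮 Ω : Type*} [NormedAddCommGroup H] [InnerProductSpace ℝ H]

/-- The iterates of the method on the realization `w · · ω` of the samples. -/
def samplePath (S : Set H) (g : H → 𝒮 → H) (α γ τ : ℝ) (t : ℕ → ℕ) (w : ℕ → ℕ → Ω → 𝒮) (z0 : H)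
    (k : ℕ) (ω : Ω) : H :=
  momentumIter S α γ τ (fun j z => sampleMean g (t j) (fun i => w j i ω) z) z0 k

lemma samplePath_mem [CompleteSpace H] {S : Set H} {g : H → 𝒮 → H} {α γ τ : ℝ} {t : ℕ → ℕ}
    {w : ℕ → ℕ → Ω → 𝒮} {z0 : H} (hc : IsClosed S) (hconv : Convex ℝ S) (hz0 : z0 ∈ S)
    (k : ℕ) (ω : Ω) :
    samplePath S g α γ τ t w z0 k ω ∈ S := by
  cases k with
  | zero => exact hz0
  | succ k =>
    rw [samplePath, momentumIter_succ]
    exact proj_mem hc hconv ⟨z0, hz0⟩ _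

end SamplePath

section StochasticVI

variable {H : Type*} [NormedAddCommGroup H] [InnerProductSpace ℝ H] [CompleteSpace H]
  [MeasurableSpace H] {𝒮 : Type*} [MeasurableSpace 𝒮] {Q : Measure 𝒮}

/-- A strongly monotone Lipschitz operator `F` on a closed convex set `S`, together with a sampler
`g` whose value `g z s` at a random `s` with law `Q` has second moment at most `V` and
estimates `F z` with a bias of norm at most `B`. -/
structure IsSampledVI (Q : Measure 𝒮) (S : Set H) (F : H → H) (g : H → 𝒮 → H) (μ L V B : ℝ) :
    Prop where
  closed : IsClosed S
  convex : Convex ℝ S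
  strongMono : ∀ z ∈ S, ∀ z' ∈ S, μ * ‖z - z'‖ ^ 2 ≤ inner ℝ (F z - F z') (z - z')
  lipschitz : ∀ z ∈ S, ∀ z' ∈ S, ‖F z - F z'‖ ≤ L * ‖z - z'‖
  measurable : Measurable (Function.uncurry g)
  memLp : ∀ z ∈ S, MemLp (g z) 2 Q
  secondMoment : ∀ z ∈ S, ∫ s, ‖g z s‖ ^ 2 ∂Q ≤ V
  bias : ∀ z ∈ S, ‖∫ s, g z s ∂Q - F z‖ ≤ B

/-- The deviation of the sampler from its mean. The point is first projected to `S`, so that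
nothing needs to be assumed about the sampler outside of `S`. -/
def noise (Q : Measure 𝒮) (S : Set H) (g : H → 𝒮 → H) (z : H) (s : 𝒮) : H :=
  g (proj S z) s - ∫ s', g (proj S z) s' ∂Q

variable {S : Set H} {F : H → H} {g : H → 𝒮 → H} {μ L V B : ℝ}

namespace IsSampledVI

lemma memLp_noise [IsProbabilityMeasure Q] (h : IsSampledVI Q S F g μ L V B) (hne : S.Nonempty)
    (z : H) : MemLp (noise Q S g z) 2 Q :=
  (h.memLp _ (proj_mem h.closed h.convex hne z)).sub (memLp_const _)

lemma integral_noise [IsProbabilityMeasure Q] (h : IsSampledVI Q S F g μ L V B)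
    (hne : S.Nonempty) (z : H) : ∫ s, noise Q S g z s ∂Q = 0 := by
  have hi := (h.memLp _ (proj_mem h.closed h.convex hne z)).integrable (by norm_num)
  simp only [noise]
  rw [integral_sub hi (integrable_const _)]
  simp

/-- Centring does not increase the second moment. -/
lemma integral_norm_noise_sq_le [IsProbabilityMeasure Q] (h : IsSampledVI Q S F g μ L V B)
    (hne : S.Nonempty) (z : H) : ∫ s, ‖noise Q S g z s‖ ^ 2 ∂Q ≤ V := by
  have hz := proj_mem h.closed h.convex hne z
  have h2 := h.memLp _ hz
  have hi := h2.integrable (by norm_num)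
  refine le_trans ?_ (h.secondMoment _ hz)
  set m := ∫ s', g (proj S z) s' ∂Q with hm
  have e : ∀ s, ‖noise Q S g z s‖ ^ 2 =
      ‖g (proj S z) s‖ ^ 2 - 2 * inner ℝ m (g (proj S z) s) + ‖m‖ ^ 2 := by
    intro s; rw [noise, norm_sub_sq_real, real_inner_comm]
  simp_rw [e]
  have i1 := integrable_norm_sq_of_memLp h2
  have i2 : Integrable (fun s => 2 * inner ℝ m (g (proj S z) s)) Q :=
    (hi.const_inner m).const_mul 2
  have i12 : Integrable (fun s => ‖g (proj S z) s‖ ^ 2 - 2 * inner ℝ m (g (proj S z) s)) Q :=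
    i1.sub i2
  rw [integral_add i12 (integrable_const _), integral_sub i1 i2, integral_const_mul,
    integral_inner hi, ← hm, real_inner_self_eq_norm_sq]
  simp only [integral_const, probReal_univ, smul_eq_mul, one_mul]
  linarith [sq_nonneg ‖m‖]

lemma continuous_comp_proj (h : IsSampledVI Q S F g μ L V B) (hL : 0 ≤ L) (hne : S.Nonempty) :
    Continuous fun z => F (proj S z) :=
  (LipschitzWith.of_dist_le_mul (K := ⟨L, hL⟩) fun z z' => by
    rw [dist_eq_norm, dist_eq_norm]
    refine (h.lipschitz _ (proj_mem h.closed h.convex hne z) _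
      (proj_mem h.closed h.convex hne z')).trans ?_
    exact mul_le_mul_of_nonneg_left
      (norm_proj_sub_proj_le h.closed h.convex hne z z') hL).continuous

/-- The averaged direction splits into the operator, the noise and the bias. -/
lemma sampleMean_eq (h : IsSampledVI Q S F g μ L V B) {z : H} (hz : z ∈ S) {t : ℕ} (ht : 0 < t)
    (s : ℕ → 𝒮) : sampleMean g t s z =
      F z + sampleMean (noise Q S g) t s z + (∫ s, g z s ∂Q - F z) := by
  have ht' : (t : ℝ) ≠ 0 := by positivity
  have : ∑ i ∈ Finset.range t, noise Q S g z (s i) =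
      ∑ i ∈ Finset.range t, g z (s i) - (t : ℝ) • ∫ s, g z s ∂Q := by
    simp [noise, proj_eq_self h.closed h.convex hz, Finset.sum_sub_distrib, Nat.cast_smul_eq_nsmul]
  rw [sampleMean, sampleMean, this, smul_sub, smul_smul, one_div, inv_mul_cancel₀ ht', one_smul]
  abel

variable [BorelSpace H] [SecondCountableTopology H]

lemma measurable_mean [SFinite Q] (h : IsSampledVI Q S F g μ L V B) (hne : S.Nonempty) :
    Measurable fun z => ∫ s, g (proj S z) s ∂Q := by
  have hp := (continuous_proj h.closed h.convex hne).measurable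
  exact (h.measurable.comp ((hp.comp measurable_fst).prodMk
    measurable_snd)).stronglyMeasurable.integral_prod_right'.measurable

lemma measurable_noise [SFinite Q] (h : IsSampledVI Q S F g μ L V B) (hne : S.Nonempty) :
    Measurable (Function.uncurry (noise Q S g)) := by
  have hp := (continuous_proj h.closed h.convex hne).measurable
  exact (h.measurable.comp ((hp.comp measurable_fst).prodMk measurable_snd)).sub
    ((h.measurable_mean hne).comp measurable_fst)

end IsSampledVI

variable [BorelSpace H] [SecondCountableTopology H] {Ω : Type*} {mΩ : MeasurableSpace Ω}
  {Pr : Measure Ω} {α γ τ : ℝ} {t : ℕ → ℕ} {w : ℕ → ℕ → Ω → 𝒮} {z0 zs : H}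

/-- The iterate `z^k` depends only on the samples of the iterations before `k`. -/
lemma measurable_samplePath (hc : IsClosed S) (hconv : Convex ℝ S) (hz0 : z0 ∈ S)
    (hg : Measurable (Function.uncurry g)) (k : ℕ) :
    Measurable[sampleSigma w {p | p.1 < k}] (samplePath S g α γ τ t w z0 k) := by
  have hp := (continuous_proj hc hconv ⟨z0, hz0⟩).measurable
  induction k using Nat.strong_induction_on with
  | _ k ih =>
    cases k with
    | zero => exact measurable_const
    | succ k =>
      have hz (j : ℕ) (hj : j < k + 1) : Measurable[sampleSigma w {p | p.1 < k + 1}]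
          (samplePath S g α γ τ t w z0 j) :=
        (ih j hj).mono (sampleSigma_mono w fun p (hp : p.1 < j) => hp.trans hj) le_rfl
      have hG (j : ℕ) (hj : j < k + 1) : Measurable[sampleSigma w {p | p.1 < k + 1}]
          (fun ω => sampleMean g (t j) (fun i => w j i ω) (samplePath S g α γ τ t w z0 j ω)) :=
        measurable_sampleMean hg (hz j hj) fun i => measurable_sample w (k := j) (i := i) hj
      have h1 := hz k (by lia)
      have h2 := hz (k - 1) (by lia)
      have h3 := hG k (by lia)
      have h4 := hG (k - 1) (by lia)
      have := hp.comp (((h1.sub (h3.const_smul α)).add ((h1.sub h2).const_smul γ)).sub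
        ((h3.sub h4).const_smul τ))
      have e : samplePath S g α γ τ t w z0 (k + 1) = _ := funext fun ω =>
        momentumIter_succ S α γ τ (fun j z => sampleMean g (t j) (fun i => w j i ω) z) z0 k
      rw [e]
      exact this

end StochasticVI

/-! ### Convergence in mean square -/

/-- The samples `w k i` are independent, with common law `Q`. -/
structure IsIID {𝒮 Ω : Type*} [MeasurableSpace 𝒮] [MeasurableSpace Ω] (Q : Measure 𝒮)
    (Pr : Measure Ω) (w : ℕ → ℕ → Ω → 𝒮) : Prop where
  measurable : ∀ k i, Measurable (w k i)
  law : ∀ k i, Pr.map (w k i) = Q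
  indep : iIndepFun (fun p : ℕ × ℕ => w p.1 p.2) Pr

section Convergence

variable {H : Type*} [NormedAddCommGroup H] [InnerProductSpace ℝ H] [CompleteSpace H]
  [MeasurableSpace H] [BorelSpace H] [SecondCountableTopology H]
  {𝒮 Ω : Type*} [MeasurableSpace 𝒮] [MeasurableSpace Ω]
  {Q : Measure 𝒮} [IsProbabilityMeasure Q] {Pr : Measure Ω} [IsProbabilityMeasure Pr]
  {S : Set H} {F : H → H} {g : H → 𝒮 → H} {μ L V B α γ τ : ℝ} {t : ℕ → ℕ} {w : ℕ → ℕ → Ω → 𝒮}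
  {z0 zs : H}

/-- The noise of the direction used in iteration `k`. -/
def pathNoise (Q : Measure 𝒮) (S : Set H) (g : H → 𝒮 → H) (α γ τ : ℝ) (t : ℕ → ℕ)
    (w : ℕ → ℕ → Ω → 𝒮) (z0 : H) (k : ℕ) (ω : Ω) : H :=
  sampleMean (noise Q S g) (t k) (fun i => w k i ω) (samplePath S g α γ τ t w z0 k ω)

/-- The noise of iteration `k` has second moment at most `V / t k` and is orthogonal to every
function of the iterate `z^k`. -/
lemma pathNoise_centred (h : IsSampledVI Q S F g μ L V B) (hz0 : z0 ∈ S)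
    (hw : IsIID Q Pr w) (ht : ∀ k, 0 < t k) (k : ℕ) :
    MemLp (pathNoise Q S g α γ τ t w z0 k) 2 Pr ∧
    ∫ ω, ‖pathNoise Q S g α γ τ t w z0 k ω‖ ^ 2 ∂Pr ≤ V / t k ∧
    ∀ ψ : H → H, Measurable ψ → MemLp (fun ω => ψ (samplePath S g α γ τ t w z0 k ω)) 2 Pr →
      ∫ ω, inner ℝ (pathNoise Q S g α γ τ t w z0 k ω)
        (ψ (samplePath S g α γ τ t w z0 k ω)) ∂Pr = 0 := by
  have hne : S.Nonempty := ⟨z0, hz0⟩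
  have hZ := measurable_samplePath (α := α) (γ := γ) (τ := τ) (t := t) (w := w)
    h.closed h.convex hz0 h.measurable k
  refine sampleMean_centred (hZ.mono (sampleSigma_le hw.measurable _) le_rfl) (hw.measurable k)
    (hw.law k) (fun i => indepFun_sample hw.measurable hw.indep (by simp) hZ)
    (fun i j hij => ?_) (h.measurable_noise hne)
    (h.memLp_noise hne) (h.integral_noise hne) (h.integral_norm_noise_sq_le hne) (ht k)
  refine indepFun_sample hw.measurable hw.indep (T := {p | p.1 < k} ∪ {(k, i)})
    (by simp [hij.symm]) ?_
  exact (hZ.mono (sampleSigma_mono w Set.subset_union_left) le_rfl).prodMk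
    (measurable_sample w (by simp))

/-- The iterates and the values of the operator at them are square integrable. -/
lemma memLp_samplePath (hL : 0 < L) (h : IsSampledVI Q S F g μ L V B) (hz0 : z0 ∈ S)
    (hw : IsIID Q Pr w) (ht : ∀ k, 0 < t k) (k : ℕ) :
    MemLp (samplePath S g α γ τ t w z0 k) 2 Pr ∧
    MemLp (fun ω => F (samplePath S g α γ τ t w z0 k ω)) 2 Pr := by
  have hne : S.Nonempty := ⟨z0, hz0⟩
  have hmeas k : Measurable (samplePath S g α γ τ t w z0 k) :=
    (measurable_samplePath h.closed h.convex hz0 h.measurable k).mono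
      (sampleSigma_le hw.measurable _) le_rfl
  have hmem k ω : samplePath S g α γ τ t w z0 k ω ∈ S :=
    samplePath_mem h.closed h.convex hz0 k ω
  have hpr k ω := proj_eq_self h.closed h.convex (hmem k ω)
  have hF k (hk : MemLp (samplePath S g α γ τ t w z0 k) 2 Pr) :
      MemLp (fun ω => F (samplePath S g α γ τ t w z0 k ω)) 2 Pr := by
    have h1 : MemLp (fun ω => F (samplePath S g α γ τ t w z0 k ω) - F z0) 2 Pr := by
      refine (hk.sub (memLp_const z0)).of_le_mul (c := L) ?_
        (ae_of_all _ fun ω => h.lipschitz _ (hmem k ω) _ hz0)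
      have := ((h.continuous_comp_proj hL.le hne).measurable.comp (hmeas k)).sub_const (F z0)
      simpa only [Function.comp_apply, hpr] using this.aestronglyMeasurable
    have e : (fun ω => F (samplePath S g α γ τ t w z0 k ω)) =
        (fun ω => F (samplePath S g α γ τ t w z0 k ω) - F z0) + fun _ => F z0 := by
      funext ω; simp
    rw [e]
    exact h1.add (memLp_const (F z0))
  suffices hz : MemLp (samplePath S g α γ τ t w z0 k) 2 Pr from ⟨hz, hF k hz⟩
  induction k using Nat.strong_induction_on with
  | _ k ih =>
    cases k with
    | zero => exact memLp_const z0
    | succ k =>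
      have hG j (hj : j < k + 1) : MemLp (fun ω => sampleMean g (t j) (fun i => w j i ω)
          (samplePath S g α γ τ t w z0 j ω)) 2 Pr := by
        have hb : MemLp (fun ω => ∫ s, g (samplePath S g α γ τ t w z0 j ω) s ∂Q
            - F (samplePath S g α γ τ t w z0 j ω)) 2 Pr := by
          refine MemLp.of_bound ?_ B (ae_of_all _ fun ω => h.bias _ (hmem j ω))
          have := (h.measurable_mean hne).comp (hmeas j)
          simp only [Function.comp_def, hpr] at this
          exact this.aestronglyMeasurable.sub (hF j (ih j hj)).1
        have := ((hF j (ih j hj)).add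
          (pathNoise_centred h hz0 hw ht (α := α) (γ := γ) (τ := τ) j).1).add hb
        refine this.congr_norm ?_ (ae_of_all _ fun ω => ?_)
        · exact (measurable_sampleMean h.measurable (hmeas j)
            (hw.measurable j)).aestronglyMeasurable
        · rw [h.sampleMean_eq (hmem j ω) (ht j)]
          rfl
      have h1 := ih k (by lia)
      have h2 := ih (k - 1) (by lia)
      have h3 := hG k (by lia)
      have h4 := hG (k - 1) (by lia)
      have h5 := ((((h1.sub (h3.const_smul α)).add ((h1.sub h2).const_smul γ)).sub
        ((h3.sub h4).const_smul τ))).sub (memLp_const z0)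
      have h6 : MemLp (fun ω => samplePath S g α γ τ t w z0 (k + 1) ω - z0) 2 Pr := by
        refine h5.of_le ((hmeas _).sub_const z0).aestronglyMeasurable (ae_of_all _ fun ω => ?_)
        have e := momentumIter_succ S α γ τ
          (fun j z => sampleMean g (t j) (fun i => w j i ω) z) z0 k
        have := norm_proj_sub_proj_le h.closed h.convex hne
          (samplePath S g α γ τ t w z0 k ω
          - α • sampleMean g (t k) (fun i => w k i ω) (samplePath S g α γ τ t w z0 k ω)
          + γ • (samplePath S g α γ τ t w z0 k ω - samplePath S g α γ τ t w z0 (k - 1) ω)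
          - τ • (sampleMean g (t k) (fun i => w k i ω) (samplePath S g α γ τ t w z0 k ω) -
            sampleMean g (t (k - 1)) (fun i => w (k - 1) i ω)
              (samplePath S g α γ τ t w z0 (k - 1) ω))) z0
        rw [proj_eq_self h.closed h.convex hz0] at this
        rw [samplePath, e]
        exact this
      have e : samplePath S g α γ τ t w z0 (k + 1) =
          (fun ω => samplePath S g α γ τ t w z0 (k + 1) ω - z0) + fun _ => z0 := by
        funext ω; simp
      rw [e]
      exact h6.add (memLp_const z0)

/-- The potential at iteration `k`; the previous iterate of `z⁰` is `z⁰` itself. -/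
def pathPotential (F : H → H) (κ : ℝ) (zs : H) (Z : ℕ → Ω → H) (α : ℝ) (k : ℕ) (ω : Ω) : ℝ :=
  potential α κ zs (Z k ω) (Z (k - 1) ω) (F (Z k ω)) (F (Z (k - 1) ω))

/-- In expectation, one step of the method contracts the potential by the factor `rate κ`, up to
the variance of the noise and the square of the bias. -/
lemma integral_pathPotential_succ {κ : ℝ} (hL : 0 < L) (hκ : 1 ≤ κ)
    (h : IsSampledVI Q S F g (L / κ) L V B) (hz0 : z0 ∈ S) (hw : IsIID Q Pr w)
    (ht : ∀ k, 0 < t k) (hzs : IsVISolution S F zs) {Z : ℕ → Ω → H}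
    (hZ : Z = samplePath S g (stepα L) (stepγ κ) (stepτ L κ) t w z0) :
    (∀ k, Integrable (pathPotential F κ zs Z (stepα L) k) Pr) ∧
    ∀ k, ∫ ω, pathPotential F κ zs Z (stepα L) (k + 1) ω ∂Pr ≤
      rate κ * ∫ ω, pathPotential F κ zs Z (stepα L) k ω ∂Pr +
      (32 * stepα L ^ 2 * (V / t k) + 16 * stepα L ^ 2 * (V / t (k - 1)) +
        18 * κ * stepα L ^ 2 * B ^ 2) := by
  have hmem k ω : Z k ω ∈ S := by rw [hZ]; exact samplePath_mem h.closed h.convex hz0 k ω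
  have hLp k : MemLp (Z k) 2 Pr ∧ MemLp (fun ω => F (Z k ω)) 2 Pr := by
    rw [hZ]; exact memLp_samplePath hL h hz0 hw ht k
  set e := pathNoise Q S g (stepα L) (stepγ κ) (stepτ L κ) t w z0 with he
  have hd k : MemLp (fun ω => Z k ω - zs) 2 Pr := (hLp k).1.sub (memLp_const zs)
  have hΔ k : MemLp (fun ω => Z k ω - Z (k - 1) ω) 2 Pr := (hLp k).1.sub (hLp (k - 1)).1
  have hFΔ k : MemLp (fun ω => F (Z k ω) - F (Z (k - 1) ω)) 2 Pr := (hLp k).2.sub (hLp (k - 1)).2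
  have hn k : MemLp (e k) 2 Pr ∧ ∫ ω, ‖e k ω‖ ^ 2 ∂Pr ≤ V / t k ∧
      ∫ ω, inner ℝ (e k ω) (Z k ω - zs) ∂Pr = 0 := by
    obtain ⟨h1, h2, h3⟩ := pathNoise_centred (α := stepα L) (γ := stepγ κ) (τ := stepτ L κ)
      h hz0 hw ht k
    refine ⟨h1, h2, ?_⟩
    have h4 := hd k
    rw [hZ] at h4 ⊢
    exact h3 (fun z => z - zs) (measurable_id.sub_const zs) h4
  have hpot k : Integrable (pathPotential F κ zs Z (stepα L) k) Pr :=
    (((integrable_norm_sq_of_memLp (hd k)).const_mul _).sub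
      ((integrable_inner_of_memLp (hFΔ k) (hd k)).const_mul _)).add
      ((integrable_norm_sq_of_memLp (hΔ k)).const_mul _)
  refine ⟨hpot, fun k => ?_⟩
  have hstep ω := potential_step (B := B) (zs := zs) (z' := Z (k + 1) ω) (z := Z k ω)
    (zp := Z (k - 1) ω) (F' := F (Z (k + 1) ω)) (F := F (Z k ω)) (Fp := F (Z (k - 1) ω))
    (e := e k ω) (ep := e (k - 1) ω) (b := ∫ s, g (Z k ω) s ∂Q - F (Z k ω))
    (bp := ∫ s, g (Z (k - 1) ω) s ∂Q - F (Z (k - 1) ω)) hL hκ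
    (by
      have hG j : F (Z j ω) + e j ω + (∫ s, g (Z j ω) s ∂Q - F (Z j ω)) =
          sampleMean g (t j) (fun i => w j i ω) (Z j ω) := by
        rw [h.sampleMean_eq (hmem j ω) (ht j), he, pathNoise, hZ]
      rw [hG, hG]
      have e' : Z (k + 1) ω = momentumStep S (stepα L) (stepγ κ) (stepτ L κ) (Z k ω) (Z (k - 1) ω)
          (sampleMean g (t k) (fun i => w k i ω) (Z k ω))
          (sampleMean g (t (k - 1)) (fun i => w (k - 1) i ω) (Z (k - 1) ω)) := by
        rw [hZ]
        exact momentumIter_succ _ _ _ _ _ _ _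
      rw [e']
      exact inner_sub_proj_nonpos h.closed h.convex ⟨z0, hz0⟩ _ hzs.1)
    (by
      have h1 := h.strongMono _ (hmem (k + 1) ω) _ hzs.1
      have h2 := hzs.2 _ (hmem (k + 1) ω)
      rw [inner_sub_left] at h1
      linarith)
    (h.lipschitz _ (hmem k ω) _ (hmem (k - 1) ω)) (h.bias _ (hmem k ω))
    (h.bias _ (hmem (k - 1) ω))
  have i1 := (hpot k).const_mul (rate κ)
  have i2 := (integrable_norm_sq_of_memLp (hn k).1).const_mul (32 * stepα L ^ 2)
  have i3 := (integrable_norm_sq_of_memLp (hn (k - 1)).1).const_mul (16 * stepα L ^ 2)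
  have i4 : Integrable (fun _ : Ω => 18 * κ * stepα L ^ 2 * B ^ 2) Pr := integrable_const _
  have i5 := (integrable_inner_of_memLp (hn k).1 (hd k)).const_mul (stepα L + stepτ L κ)
  have i6 := (integrable_inner_of_memLp (hn (k - 1)).1 (hd (k - 1))).const_mul (stepτ L κ)
  have key := integral_mono (hpot (k + 1)) (((i1.add ((i2.add i3).add i4)).sub i5).add i6) hstep
  rw [integral_add' ((i1.add ((i2.add i3).add i4)).sub i5) i6,
    integral_sub' (i1.add ((i2.add i3).add i4)) i5, integral_add' i1 ((i2.add i3).add i4),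
    integral_add' (i2.add i3) i4, integral_add' i2 i3] at key
  simp only [integral_const_mul, (hn k).2.2, (hn (k - 1)).2.2, integral_const, probReal_univ,
    smul_eq_mul, one_mul, mul_zero, sub_zero, add_zero] at key
  refine key.trans ?_
  gcongr
  · exact (hn k).2.1
  · exact (hn (k - 1)).2.1

/-- Linear convergence of the method when the batch sizes grow at the rate of the method and
the bias is of the order of the target accuracy. -/
theorem integral_norm_samplePath_sub_sq_le {κ R c : ℝ} {K : ℕ} (hL : 0 < L) (hκ : 1 ≤ κ)
    (h : IsSampledVI Q S F g (L / κ) L V B) (hz0 : z0 ∈ S) (hw : IsIID Q Pr w) (hK : 0 < K)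
    (ht : ∀ k : ℕ, K * rate κ ^ (-(k : ℤ)) ≤ t k) (hzs : IsVISolution S F zs)
    (hR : ‖z0 - zs‖ ≤ R) (hB : κ ^ 2 * B ^ 2 ≤ c * rate κ ^ K) {Z : ℕ → Ω → H}
    (hZ : Z = samplePath S g (stepα L) (stepγ κ) (stepτ L κ) t w z0) :
    Integrable (fun ω => ‖Z K ω - zs‖ ^ 2) Pr ∧
    ∫ ω, ‖Z K ω - zs‖ ^ 2 ∂Pr ≤ rate κ ^ K * (9 / 4 * R ^ 2 + (15 * V + 41 * c) / L ^ 2) := by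
  have hq := rate_pos hκ
  have hq1 := rate_lt_one hκ
  have hq8 := le_rate hκ
  have hK' : (0 : ℝ) < K := by exact_mod_cast hK
  have ht0 k : 0 < t k := by
    have : (0 : ℝ) < t k := lt_of_lt_of_le (by positivity) (ht k)
    exact_mod_cast this
  have hV : 0 ≤ V := (integral_nonneg fun s => by positivity).trans (h.secondMoment z0 hz0)
  have hmem k ω : Z k ω ∈ S := by rw [hZ]; exact samplePath_mem h.closed h.convex hz0 k ω
  have hd : MemLp (fun ω => Z K ω - zs) 2 Pr := by
    rw [hZ]; exact (memLp_samplePath hL h hz0 hw ht0 K).1.sub (memLp_const zs)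
  refine ⟨integrable_norm_sq_of_memLp hd, ?_⟩
  obtain ⟨hpot, hrec⟩ := integral_pathPotential_succ hL hκ h hz0 hw ht0 hzs hZ
  set q := rate κ
  set a : ℕ → ℝ := fun k => ∫ ω, pathPotential F κ zs Z (stepα L) k ω ∂Pr
  have hα2 : stepα L ^ 2 = 1 / 16 / L ^ 2 := by unfold stepα; field_simp; norm_num
  have hVt k : V / t k ≤ V / K * q ^ k := by
    have h1 : (K : ℝ) / q ^ k ≤ t k := by simpa [div_eq_mul_inv] using ht k
    calc V / t k ≤ V / (K / q ^ k) := by gcongr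
      _ = V / K * q ^ k := by field_simp
  have hVt' k : V / t (k - 1) ≤ 9 / 8 * (V / K * q ^ k) := by
    refine (hVt _).trans ?_
    have : q ^ (k - 1) ≤ 9 / 8 * q ^ k := by
      cases k with
      | zero => norm_num
      | succ k =>
        rw [Nat.add_sub_cancel, pow_succ]
        have : 0 < q ^ k := by positivity
        nlinarith
    calc V / K * q ^ (k - 1) ≤ V / K * (9 / 8 * q ^ k) := by gcongr
      _ = _ := by ring
  -- `K` perturbations of size `q ^ k V / K`, each damped by `q ^ (K - 1 - k)`, add up to `q ^ K V`
  have hrec' k : a (k + 1) ≤ q * a k + 50 * stepα L ^ 2 * (V / K) * q ^ k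
      + 18 * κ * stepα L ^ 2 * B ^ 2 := by
    have h1 := mul_le_mul_of_nonneg_left (hVt k) (by positivity : 0 ≤ 32 * stepα L ^ 2)
    have h2 := mul_le_mul_of_nonneg_left (hVt' k) (by positivity : 0 ≤ 16 * stepα L ^ 2)
    linarith [hrec k]
  have ha := le_of_perturbed_contraction hq hq1 hrec' K
  have ha0 : a 0 ≤ 9 / 16 * R ^ 2 := by
    have e : ∀ ω, pathPotential F κ zs Z (stepα L) 0 ω =
        1 / 2 * (1 + 1 / (8 * κ)) * ‖z0 - zs‖ ^ 2 := by
      intro ω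
      have : Z 0 ω = z0 := by rw [hZ]; rfl
      simp [pathPotential, potential, this]
    simp only [a, e, integral_const, probReal_univ, smul_eq_mul, one_mul]
    have h1 : 1 / (8 * κ) ≤ 1 / 8 := by gcongr; linarith
    calc 1 / 2 * (1 + 1 / (8 * κ)) * ‖z0 - zs‖ ^ 2 ≤ 1 / 2 * (1 + 1 / 8) * R ^ 2 := by gcongr
      _ = 9 / 16 * R ^ 2 := by ring
  have hnoise : K * (50 * stepα L ^ 2 * (V / K) / q) ≤ 57 * stepα L ^ 2 * V := by
    rw [mul_div_assoc', div_le_iff₀ hq]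
    have : K * (50 * stepα L ^ 2 * (V / K)) = stepα L ^ 2 * V * 50 := by field_simp
    rw [this]
    have : 0 ≤ stepα L ^ 2 * V := by positivity
    nlinarith
  -- the geometric series of the bias costs a factor `κ`, absorbed by `κ² B² ≤ c q ^ K`
  have hbias : 18 * κ * stepα L ^ 2 * B ^ 2 * (1 - q ^ K) / (1 - q) ≤
      q ^ K * (162 * stepα L ^ 2 * c) := by
    have h1 : 1 / (1 - q) = 8 * κ + 1 := by simp only [q, rate]; field_simp; ring
    have hqK : 0 < q ^ K := by positivity
    calc 18 * κ * stepα L ^ 2 * B ^ 2 * (1 - q ^ K) / (1 - q)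
        = 18 * κ * stepα L ^ 2 * B ^ 2 * (1 - q ^ K) * (8 * κ + 1) := by
          rw [div_eq_mul_one_div, h1]
      _ ≤ 18 * κ * stepα L ^ 2 * B ^ 2 * 1 * (9 * κ) := by
          gcongr
          · linarith
          · linarith
      _ = 162 * stepα L ^ 2 * (κ ^ 2 * B ^ 2) := by ring
      _ ≤ 162 * stepα L ^ 2 * (c * q ^ K) := by gcongr
      _ = _ := by ring
  have hlow : 1 / 4 * ∫ ω, ‖Z K ω - zs‖ ^ 2 ∂Pr ≤ a K := by
    rw [← integral_const_mul]
    exact integral_mono ((integrable_norm_sq_of_memLp hd).const_mul _) (hpot K) fun ω =>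
      quarter_norm_sq_le_potential hL hκ (h.lipschitz _ (hmem K ω) _ (hmem (K - 1) ω))
  have hc : 0 ≤ c := by
    have h1 : 0 ≤ c * q ^ K := le_trans (by positivity) hB
    exact nonneg_of_mul_nonneg_left h1 (by positivity)
  have hqK : 0 < q ^ K := by positivity
  calc ∫ ω, ‖Z K ω - zs‖ ^ 2 ∂Pr ≤ 4 * a K := by linarith
    _ ≤ 4 * (q ^ K * (9 / 16 * R ^ 2 + 57 * stepα L ^ 2 * V)
        + q ^ K * (162 * stepα L ^ 2 * c)) := by
        have := mul_le_mul_of_nonneg_left (add_le_add ha0 hnoise) hqK.le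
        linarith
    _ = q ^ K * (9 / 4 * R ^ 2 + (57 / 4 * V + 81 / 2 * c) / L ^ 2) := by
        rw [hα2]; ring
    _ ≤ q ^ K * (9 / 4 * R ^ 2 + (15 * V + 41 * c) / L ^ 2) := by
        gcongr <;> norm_num

end Convergence

/-! ### The uniform distribution on the sphere -/

section Sphere

open scoped Pointwise

variable {n : ℕ}

lemma sphereUniform_apply {s : Set (EuclideanSpace ℝ (Fin n))} (hs : MeasurableSet s) :
    sphereUniform n s =
      ((volume : Measure (EuclideanSpace ℝ (Fin n))).toSphere Set.univ)⁻¹ *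
        (n * volume (Set.Ioo (0 : ℝ) 1 • (s ∩ Metric.sphere 0 1))) := by
  rw [sphereUniform, Measure.map_apply measurable_subtype_coe hs, Measure.smul_apply, smul_eq_mul,
    Measure.toSphere_apply' _ (measurable_subtype_coe hs), Subtype.image_preimage_coe,
    Set.inter_comm]
  simp

lemma isProbabilityMeasure_sphereUniform (hn : 1 ≤ n) : IsProbabilityMeasure (sphereUniform n) := by
  have : Nonempty (Fin n) := ⟨⟨0, hn⟩⟩
  refine ⟨?_⟩
  rw [sphereUniform, Measure.map_apply measurable_subtype_coe .univ, Measure.smul_apply,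
    smul_eq_mul, Set.preimage_univ]
  refine ENNReal.inv_mul_cancel ?_ (measure_ne_top _ _)
  rw [Ne, Measure.measure_univ_eq_zero]
  exact Measure.toSphere_ne_zero _

lemma ae_norm_eq_one_sphereUniform : ∀ᵐ u ∂sphereUniform n, ‖u‖ = 1 := by
  rw [sphereUniform, ae_map_iff measurable_subtype_coe.aemeasurable
    (measurableSet_eq_fun measurable_norm measurable_const)]
  exact ae_of_all _ fun u => by simp

/-- The uniform distribution on the sphere is invariant under linear isometries. -/
lemma map_sphereUniform
    (g : EuclideanSpace ℝ (Fin n) ≃ₗᵢ[ℝ] EuclideanSpace ℝ (Fin n)) :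
    (sphereUniform n).map g = sphereUniform n := by
  ext s hs
  have hg : Measurable g := g.continuous.measurable
  rw [Measure.map_apply hg hs, sphereUniform_apply (hg hs), sphereUniform_apply hs]
  have e : Set.Ioo (0 : ℝ) 1 • (g ⁻¹' s ∩ Metric.sphere 0 1) =
      g ⁻¹' (Set.Ioo (0 : ℝ) 1 • (s ∩ Metric.sphere 0 1)) := by
    ext x
    simp only [Set.mem_smul, Set.mem_inter_iff, Set.mem_preimage, mem_sphere_zero_iff_norm]
    constructor
    · rintro ⟨r, hr, u, ⟨hu, hu1⟩, rfl⟩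
      exact ⟨r, hr, g u, ⟨hu, by simpa using hu1⟩, by simp⟩
    · rintro ⟨r, hr, u, ⟨hu, hu1⟩, hx⟩
      refine ⟨r, hr, g.symm u, ⟨by simpa using hu, by simpa using hu1⟩, ?_⟩
      apply g.injective
      rw [← hx]; simp
  rw [e, g.measurePreserving.measure_preimage_emb g.toHomeomorph.measurableEmbedding]

lemma integrable_of_bound_on_sphere [IsProbabilityMeasure (sphereUniform n)]
    {E : Type*} [NormedAddCommGroup E] {φ : EuclideanSpace ℝ (Fin n) → E}
    (hφ : AEStronglyMeasurable φ (sphereUniform n)) (C : ℝ) (hC : ∀ u, ‖u‖ = 1 → ‖φ u‖ ≤ C) :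
    Integrable φ (sphereUniform n) :=
  (integrable_const C).mono' hφ (ae_norm_eq_one_sphereUniform.mono hC)

lemma integrable_inner_sq_sphereUniform [IsProbabilityMeasure (sphereUniform n)]
    (a : EuclideanSpace ℝ (Fin n)) :
    Integrable (fun u => (inner ℝ a u) ^ 2) (sphereUniform n) := by
  refine integrable_of_bound_on_sphere (by fun_prop) (‖a‖ ^ 2) fun u hu => ?_
  have := abs_real_inner_le_norm a u
  rw [hu, mul_one] at this
  rw [norm_pow, Real.norm_eq_abs]
  gcongr

/-- Reflections show that the second moment in the direction `a` depends on `‖a‖` only. -/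
lemma integral_inner_sq_sphereUniform_congr {a b : EuclideanSpace ℝ (Fin n)} (h : ‖a‖ = ‖b‖) :
    ∫ u, (inner ℝ a u) ^ 2 ∂sphereUniform n = ∫ u, (inner ℝ b u) ^ 2 ∂sphereUniform n := by
  set g := Submodule.reflection (ℝ ∙ (a - b))ᗮ with hg
  have hga : g a = b := Submodule.reflection_sub h
  conv_rhs => rw [← map_sphereUniform g]
  rw [integral_map g.continuous.measurable.aemeasurable (by fun_prop)]
  simp_rw [← hga, LinearIsometryEquiv.inner_map_map]

lemma integral_inner_sq_sphereUniform (hn : 1 ≤ n) (a : EuclideanSpace ℝ (Fin n)) :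
    ∫ u, (inner ℝ a u) ^ 2 ∂sphereUniform n = ‖a‖ ^ 2 / n := by
  have := isProbabilityMeasure_sphereUniform hn
  have hn' : (0 : ℝ) < n := by exact_mod_cast hn
  let e (i : Fin n) : EuclideanSpace ℝ (Fin n) := EuclideanSpace.single i 1
  let i0 : Fin n := ⟨0, hn⟩
  -- the coordinates of a unit vector have squares of sum `1`, and equal second moments
  have h1 : ∑ i, ∫ u, (inner ℝ (e i) u) ^ 2 ∂sphereUniform n = 1 := by
    rw [← integral_finsetSum _ fun i _ => integrable_inner_sq_sphereUniform (e i)]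
    have : ∀ᵐ u ∂sphereUniform n, ∑ i, (inner ℝ (e i) u) ^ 2 = (1 : ℝ) := by
      filter_upwards [ae_norm_eq_one_sphereUniform] with u hu
      have := EuclideanSpace.real_norm_sq_eq u
      rw [hu] at this
      simpa [e, EuclideanSpace.inner_single_left] using this.symm
    rw [integral_congr_ae this]
    simp
  have h2 : ∀ i ∈ Finset.univ, ∫ u, (inner ℝ (e i) u) ^ 2 ∂sphereUniform n =
      ∫ u, (inner ℝ (e i0) u) ^ 2 ∂sphereUniform n := fun i _ =>
    integral_inner_sq_sphereUniform_congr (by simp [e])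
  rw [Finset.sum_congr rfl h2, Finset.sum_const, Finset.card_univ, Fintype.card_fin,
    nsmul_eq_mul] at h1
  rw [integral_inner_sq_sphereUniform_congr (b := ‖a‖ • e i0) (by simp [e, norm_smul])]
  simp_rw [inner_smul_left, mul_pow]
  rw [integral_const_mul]
  simp only [conj_trivial]
  field_simp
  linear_combination (‖a‖ ^ 2) * h1

/-- The covariance of the uniform distribution on the sphere of `ℝⁿ` is `1 / n` times the
identity. -/
lemma integral_inner_smul_sphereUniform (hn : 1 ≤ n) (a : EuclideanSpace ℝ (Fin n)) :
    ∫ u, (inner ℝ a u) • u ∂sphereUniform n = (1 / (n : ℝ)) • a := by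
  have := isProbabilityMeasure_sphereUniform hn
  have hi : Integrable (fun u : EuclideanSpace ℝ (Fin n) => (inner ℝ a u : ℝ) • u)
      (sphereUniform n) := by
    refine integrable_of_bound_on_sphere (by fun_prop) ‖a‖ fun u hu => ?_
    have := abs_real_inner_le_norm a u
    rw [norm_smul, hu, mul_one, Real.norm_eq_abs]
    simpa [hu] using this
  refine ext_inner_left ℝ fun b => ?_
  rw [← integral_inner hi, inner_smul_right]
  -- polarization
  have e u : inner ℝ b ((inner ℝ a u : ℝ) • u) =
      ((inner ℝ (a + b) u : ℝ) ^ 2 - (inner ℝ (a - b) u) ^ 2) / 4 := by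
    rw [inner_smul_right, inner_add_left, inner_sub_left]; ring
  simp_rw [e]
  rw [integral_div, integral_sub (integrable_inner_sq_sphereUniform _)
    (integrable_inner_sq_sphereUniform _), integral_inner_sq_sphereUniform hn,
    integral_inner_sq_sphereUniform hn, norm_add_sq_real, norm_sub_sq_real, real_inner_comm b a]
  ring

end Sphere

/-! ### One-sided gradient estimates from noisy values -/

section OneBlock

/-- A function `φ` that is smooth on the unit ball around `x`, observed through the noisy
values `φhat · ξ`, where `ξ` has law `P`. -/
structure IsNoisyFunction {n : ℕ} {Ξ : Type*} [MeasurableSpace Ξ] (P : Measure Ξ)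
    (φ : EuclideanSpace ℝ (Fin n) → ℝ) (φhat : EuclideanSpace ℝ (Fin n) → Ξ → ℝ)
    (x : EuclideanSpace ℝ (Fin n)) (ℓ M σ : ℝ) : Prop where
  differentiable : ∀ p ∈ Metric.closedBall x 1, DifferentiableAt ℝ φ p
  lipschitz : ∀ p ∈ Metric.closedBall x 1, ‖gradient φ p - gradient φ x‖ ≤ ℓ * ‖p - x‖
  bound : ‖gradient φ x‖ ≤ M
  measurable : Measurable (Function.uncurry φhat)
  differentiable_hat : ∀ ξ, ∀ p ∈ Metric.closedBall x 1, DifferentiableAt ℝ (fun p => φhat p ξ) p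
  mean : ∀ p ∈ Metric.closedBall x 1, Integrable (φhat p) P ∧ ∫ ξ, φhat p ξ ∂P = φ p
  aestronglyMeasurable_gradient : ∀ p ∈ Metric.closedBall x 1,
    AEStronglyMeasurable (fun ξ => gradient (fun p => φhat p ξ) p) P
  variance : ∀ p ∈ Metric.closedBall x 1,
    Integrable (fun ξ => ‖gradient (fun p => φhat p ξ) p - gradient φ p‖ ^ 2) P ∧
      ∫ ξ, ‖gradient (fun p => φhat p ξ) p - gradient φ p‖ ^ 2 ∂P ≤ σ ^ 2

/-- The Cauchy–Schwarz inequality for a function and a constant. -/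
lemma sq_integral_le {a : ℝ} (ha : 0 < a) {φ : ℝ → ℝ}
    (h1 : Integrable φ (volume.restrict (Set.Ioc 0 a)))
    (h2 : Integrable (fun t => φ t ^ 2) (volume.restrict (Set.Ioc 0 a))) :
    (∫ t in Set.Ioc 0 a, φ t) ^ 2 ≤ a * ∫ t in Set.Ioc 0 a, φ t ^ 2 := by
  set I := ∫ t in Set.Ioc 0 a, φ t with hI
  have h : 0 ≤ ∫ t in Set.Ioc 0 a, (φ t - I / a) ^ 2 := integral_nonneg fun t => by positivity
  have e : ∀ t, (φ t - I / a) ^ 2 = φ t ^ 2 - 2 * (I / a) * φ t + (I / a) ^ 2 := fun t => by ring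
  simp_rw [e] at h
  have i12 : Integrable (fun t => φ t ^ 2 - 2 * (I / a) * φ t) (volume.restrict (Set.Ioc 0 a)) :=
    h2.sub (h1.const_mul _)
  rw [integral_add i12 (integrable_const _), integral_sub h2 (h1.const_mul _),
    integral_const_mul, ← hI] at h
  simp only [integral_const, measureReal_restrict_apply_univ, Real.volume_real_Ioc, sub_zero,
    max_eq_left ha.le, smul_eq_mul] at h
  have h3 : a * (∫ t in Set.Ioc 0 a, φ t ^ 2) - I ^ 2 =
      a * ((∫ t in Set.Ioc 0 a, φ t ^ 2) - 2 * (I / a) * I + a * (I / a) ^ 2) := by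
    field_simp; ring
  have h4 := mul_nonneg ha.le h
  linarith

variable {n : ℕ} {Ξ : Type*} [MeasurableSpace Ξ] {P : Measure Ξ}
  {φ : EuclideanSpace ℝ (Fin n) → ℝ} {φhat : EuclideanSpace ℝ (Fin n) → Ξ → ℝ}
  {x : EuclideanSpace ℝ (Fin n)} {ℓ M σ ρ : ℝ}

lemma add_smul_mem_closedBall (x : EuclideanSpace ℝ (Fin n)) {u : EuclideanSpace ℝ (Fin n)}
    (hu : ‖u‖ = 1) {t : ℝ} (ht0 : 0 ≤ t) (ht : t ≤ 1) :
    x + t • u ∈ Metric.closedBall x 1 := by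
  rw [mem_closedBall_iff_norm, add_sub_cancel_left, norm_smul, hu, mul_one,
    Real.norm_of_nonneg ht0]
  exact ht

namespace IsNoisyFunction

lemma integral_norm_gradient_sq_le [IsProbabilityMeasure P] (h : IsNoisyFunction P φ φhat x ℓ M σ)
    (hℓ : 0 ≤ ℓ) {p : EuclideanSpace ℝ (Fin n)} (hp : p ∈ Metric.closedBall x 1) :
    Integrable (fun ξ => ‖gradient (fun p => φhat p ξ) p‖ ^ 2) P ∧
      ∫ ξ, ‖gradient (fun p => φhat p ξ) p‖ ^ 2 ∂P ≤ 2 * σ ^ 2 + 2 * (M + ℓ) ^ 2 := by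
  have hv := h.variance p hp
  have hM : ‖gradient φ p‖ ≤ M + ℓ := by
    have h1 := h.lipschitz p hp
    have h2 := mem_closedBall_iff_norm.1 hp
    calc ‖gradient φ p‖ = ‖gradient φ x + (gradient φ p - gradient φ x)‖ := by
          rw [add_sub_cancel]
      _ ≤ ‖gradient φ x‖ + ‖gradient φ p - gradient φ x‖ := norm_add_le _ _
      _ ≤ M + ℓ * 1 := add_le_add h.bound (h1.trans (by gcongr))
      _ = M + ℓ := by rw [mul_one]
  have hpt ξ : ‖gradient (fun p => φhat p ξ) p‖ ^ 2 ≤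
      2 * ‖gradient (fun p => φhat p ξ) p - gradient φ p‖ ^ 2 + 2 * (M + ℓ) ^ 2 := by
    have h1 : ‖gradient (fun p => φhat p ξ) p‖ ≤
        ‖gradient (fun p => φhat p ξ) p - gradient φ p‖ + (M + ℓ) := by
      have := norm_add_le (gradient (fun p => φhat p ξ) p - gradient φ p) (gradient φ p)
      rw [sub_add_cancel] at this
      linarith
    have h2 := pow_le_pow_left₀ (norm_nonneg _) h1 2
    nlinarith [sq_nonneg (‖gradient (fun p => φhat p ξ) p - gradient φ p‖ - (M + ℓ))]
  have hI : Integrable (fun ξ => 2 * ‖gradient (fun p => φhat p ξ) p - gradient φ p‖ ^ 2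
      + 2 * (M + ℓ) ^ 2) P := (hv.1.const_mul 2).add (integrable_const _)
  have hI' : Integrable (fun ξ => ‖gradient (fun p => φhat p ξ) p‖ ^ 2) P :=
    hI.mono' ((h.aestronglyMeasurable_gradient p hp).norm.pow 2) (ae_of_all _ fun ξ => by
      rw [Real.norm_of_nonneg (by positivity)]; exact hpt ξ)
  refine ⟨hI', (integral_mono hI' hI hpt).trans ?_⟩
  rw [integral_add (hv.1.const_mul 2) (integrable_const _), integral_const_mul]
  simp only [integral_const, probReal_univ, smul_eq_mul, one_mul]
  linarith [hv.2]

/-- The increments of the noisy function are of the order of the distance, in mean square. The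
increment is the integral of the directional derivative along the segment, which is known to be
integrable for almost every `ξ` only: this is where Tonelli's theorem is used. -/
lemma integral_increment_sq_le [IsProbabilityMeasure P] (h : IsNoisyFunction P φ φhat x ℓ M σ)
    (hℓ : 0 ≤ ℓ) (hρ : 0 < ρ) (hρ1 : ρ ≤ 1) {u : EuclideanSpace ℝ (Fin n)} (hu : ‖u‖ = 1) :
    Integrable (fun ξ => (φhat (x + ρ • u) ξ - φhat x ξ) ^ 2) P ∧
      ∫ ξ, (φhat (x + ρ • u) ξ - φhat x ξ) ^ 2 ∂P ≤ ρ ^ 2 * (2 * σ ^ 2 + 2 * (M + ℓ) ^ 2) := by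
  set C := 2 * σ ^ 2 + 2 * (M + ℓ) ^ 2
  have hC : 0 ≤ C := by positivity
  set ν := (volume : Measure ℝ).restrict (Set.Ioc 0 ρ) with hν
  set D : ℝ → Ξ → ℝ := fun t ξ => inner ℝ (gradient (fun p => φhat p ξ) (x + t • u)) u with hD
  have hmem {t : ℝ} (ht : t ∈ Set.Icc 0 ρ) : x + t • u ∈ Metric.closedBall x 1 :=
    add_smul_mem_closedBall x hu ht.1 (ht.2.trans hρ1)
  have hderiv ξ {t : ℝ} (ht : t ∈ Set.Icc 0 ρ) :
      HasDerivAt (fun t => φhat (x + t • u) ξ) (D t ξ) t := by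
    have h1 := (h.differentiable_hat ξ _ (hmem ht)).hasGradientAt.hasFDerivAt
    have h2 : HasDerivAt (fun t : ℝ => x + t • u) u t := by
      simpa using ((hasDerivAt_id t).smul_const u).const_add x
    have h3 := h1.comp_hasDerivAt t h2
    rw [InnerProductSpace.toDual_apply_apply] at h3
    exact h3
  have hhat : Measurable fun p : ℝ × Ξ => φhat (x + p.1 • u) p.2 :=
    h.measurable.comp
      ((by fun_prop : Measurable fun p : ℝ × Ξ => x + p.1 • u).prodMk measurable_snd)
  -- the derivative is a limit of measurable difference quotients
  have hDm : AEStronglyMeasurable (Function.uncurry D) (ν.prod P) := by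
    refine aestronglyMeasurable_of_tendsto_ae Filter.atTop
      (f := fun (k : ℕ) (p : ℝ × Ξ) => ((1 / ((k : ℝ) + 1))⁻¹ *
        (φhat (x + (p.1 + 1 / ((k : ℝ) + 1)) • u) p.2 - φhat (x + p.1 • u) p.2))) (fun k => ?_) ?_
    · refine (Measurable.const_mul ?_ _).aestronglyMeasurable
      exact (hhat.comp (by fun_prop : Measurable fun p : ℝ × Ξ =>
        (p.1 + 1 / ((k : ℝ) + 1), p.2))).sub hhat
    · have h1 : ∀ᵐ p ∂ν.prod P, p.1 ∈ Set.Ioc 0 ρ :=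
        Measure.quasiMeasurePreserving_fst.ae (ae_restrict_mem measurableSet_Ioc)
      filter_upwards [h1] with p hp
      have h2 := (hasDerivAt_iff_tendsto_slope_zero.1 (hderiv p.2 (Set.Ioc_subset_Icc_self hp)))
      have h3 : Filter.Tendsto (fun k : ℕ => 1 / ((k : ℝ) + 1)) Filter.atTop (nhdsWithin 0 {0}ᶜ) :=
        tendsto_nhdsWithin_iff.2 ⟨tendsto_one_div_add_atTop_nhds_zero_nat, .of_forall fun k => by
          have : (0 : ℝ) < 1 / ((k : ℝ) + 1) := by positivity
          simpa using this.ne'⟩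
      exact h2.comp h3
  have hsec {t : ℝ} (ht : t ∈ Set.Ioc 0 ρ) :
      Integrable (fun ξ => D t ξ ^ 2) P ∧ ∫ ξ, D t ξ ^ 2 ∂P ≤ C := by
    have hp := hmem (Set.Ioc_subset_Icc_self ht)
    obtain ⟨h1, h2⟩ := h.integral_norm_gradient_sq_le hℓ hp
    have hpt ξ : D t ξ ^ 2 ≤ ‖gradient (fun p => φhat p ξ) (x + t • u)‖ ^ 2 := by
      have := abs_real_inner_le_norm (gradient (fun p => φhat p ξ) (x + t • u)) u
      rw [hu, mul_one] at this
      rw [← sq_abs]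
      gcongr
    have h3 : Integrable (fun ξ => D t ξ ^ 2) P := by
      refine h1.mono' ?_ (ae_of_all _ fun ξ => ?_)
      · exact ((h.aestronglyMeasurable_gradient _ hp).inner aestronglyMeasurable_const).pow 2
      · rw [Real.norm_of_nonneg (sq_nonneg _)]; exact hpt ξ
    exact ⟨h3, (integral_mono h3 h1 hpt).trans h2⟩
  have hsec' : ∀ᵐ t ∂ν, Integrable (fun ξ => D t ξ ^ 2) P ∧ ∫ ξ, D t ξ ^ 2 ∂P ≤ C := by
    filter_upwards [ae_restrict_mem measurableSet_Ioc] with t ht using hsec ht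
  have hD2 : Integrable (Function.uncurry fun t ξ => D t ξ ^ 2) (ν.prod P) := by
    have hm : AEStronglyMeasurable (Function.uncurry fun t ξ => D t ξ ^ 2) (ν.prod P) := hDm.pow 2
    refine (integrable_prod_iff hm).2 ⟨hsec'.mono fun t ht => ht.1, ?_⟩
    refine (integrable_const C).mono' hm.norm.integral_prod_right' ?_
    filter_upwards [hsec'] with t ht
    rw [Real.norm_of_nonneg (integral_nonneg fun _ => norm_nonneg _)]
    simpa [Function.uncurry] using ht.2
  have hD1 : Integrable (Function.uncurry D) (ν.prod P) := by
    refine (hD2.add (integrable_const 1)).mono' hDm (ae_of_all _ fun p => ?_)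
    simp only [Function.uncurry, Pi.add_apply, Real.norm_eq_abs]
    nlinarith [sq_abs (D p.1 p.2), sq_nonneg (|D p.1 p.2| - 1)]
  have hpt : ∀ᵐ ξ ∂P, (φhat (x + ρ • u) ξ - φhat x ξ) ^ 2 ≤ ρ * ∫ t, D t ξ ^ 2 ∂ν := by
    filter_upwards [hD1.prod_left_ae, hD2.prod_left_ae] with ξ h1 h2
    have h3 : ∫ t in (0)..ρ, D t ξ = φhat (x + ρ • u) ξ - φhat x ξ := by
      rw [intervalIntegral.integral_eq_sub_of_hasDerivAt (f := fun t => φhat (x + t • u) ξ)]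
      · simp
      · intro t ht
        rw [Set.uIcc_of_le hρ.le] at ht
        exact hderiv ξ ht
      · rw [intervalIntegrable_iff_integrableOn_Ioc_of_le hρ.le]
        exact h1
    rw [← h3, intervalIntegral.integral_of_le hρ.le]
    exact sq_integral_le hρ h1 h2
  have hswap : ∫ ξ, ∫ t, D t ξ ^ 2 ∂ν ∂P = ∫ t, ∫ ξ, D t ξ ^ 2 ∂P ∂ν :=
    (integral_integral_swap hD2).symm
  have hR : Integrable (fun ξ => ρ * ∫ t, D t ξ ^ 2 ∂ν) P := hD2.integral_prod_right.const_mul ρ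
  have hL : Integrable (fun ξ => (φhat (x + ρ • u) ξ - φhat x ξ) ^ 2) P := by
    refine hR.mono' ?_ (hpt.mono fun ξ hξ => ?_)
    · exact (((h.measurable.comp measurable_prodMk_left).sub
        (h.measurable.comp measurable_prodMk_left)).pow_const 2).aestronglyMeasurable
    · rw [Real.norm_of_nonneg (sq_nonneg _)]; exact hξ
  refine ⟨hL, (integral_mono_ae hL hR hpt).trans ?_⟩
  rw [integral_const_mul, hswap]
  have h5 : ∫ t, ∫ ξ, D t ξ ^ 2 ∂P ∂ν ≤ ∫ _, C ∂ν :=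
    integral_mono_ae hD2.integral_prod_left (integrable_const C) (hsec'.mono fun t ht => ht.2)
  have h6 : ∫ _, C ∂ν = ρ * C := by
    simp [hν, hρ.le]
  rw [h6] at h5
  calc ρ * ∫ t, ∫ ξ, D t ξ ^ 2 ∂P ∂ν ≤ ρ * (ρ * C) := by gcongr
    _ = ρ ^ 2 * C := by ring

end IsNoisyFunction

/-- The one-sided estimate of the gradient at `x` from one sample `(ξ, u)`. -/
def blockGrad (φhat : EuclideanSpace ℝ (Fin n) → Ξ → ℝ) (ρ : ℝ) (x : EuclideanSpace ℝ (Fin n))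
    (p : Ξ × EuclideanSpace ℝ (Fin n)) : EuclideanSpace ℝ (Fin n) :=
  (n / ρ * (φhat (x + ρ • p.2) p.1 - φhat x p.1)) • p.2

namespace IsNoisyFunction

lemma measurable_blockGrad (h : IsNoisyFunction P φ φhat x ℓ M σ) :
    Measurable (blockGrad φhat ρ x) := by
  have h1 : Measurable fun p : Ξ × EuclideanSpace ℝ (Fin n) => φhat (x + ρ • p.2) p.1 :=
    h.measurable.comp ((by fun_prop : Measurable fun p : Ξ × EuclideanSpace ℝ (Fin n) =>
      x + ρ • p.2).prodMk measurable_fst)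
  have h2 : Measurable fun p : Ξ × EuclideanSpace ℝ (Fin n) => φhat x p.1 :=
    h.measurable.comp (measurable_const.prodMk measurable_fst)
  exact ((h1.sub h2).const_mul _).smul measurable_snd

/-- The second moment of the one-sided estimate is bounded independently of the radius. -/
lemma memLp_blockGrad [IsProbabilityMeasure P] (h : IsNoisyFunction P φ φhat x ℓ M σ)
    (hn : 1 ≤ n) (hℓ : 0 ≤ ℓ) (hρ : 0 < ρ) (hρ1 : ρ ≤ 1) :
    MemLp (blockGrad φhat ρ x) 2 (P.prod (sphereUniform n)) ∧
      ∫ p, ‖blockGrad φhat ρ x p‖ ^ 2 ∂(P.prod (sphereUniform n)) ≤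
        n ^ 2 * (2 * σ ^ 2 + 2 * (M + ℓ) ^ 2) := by
  have := isProbabilityMeasure_sphereUniform hn
  have hm := (h.measurable_blockGrad (ρ := ρ)).aestronglyMeasurable
    (μ := P.prod (sphereUniform n))
  set C := 2 * σ ^ 2 + 2 * (M + ℓ) ^ 2
  have hsec : ∀ᵐ u ∂sphereUniform n, Integrable (fun ξ => ‖blockGrad φhat ρ x (ξ, u)‖ ^ 2) P ∧
      ∫ ξ, ‖blockGrad φhat ρ x (ξ, u)‖ ^ 2 ∂P ≤ n ^ 2 * C := by
    filter_upwards [ae_norm_eq_one_sphereUniform] with u hu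
    obtain ⟨h1, h2⟩ := h.integral_increment_sq_le hℓ hρ hρ1 hu
    have e ξ : ‖blockGrad φhat ρ x (ξ, u)‖ ^ 2 =
        (n / ρ) ^ 2 * (φhat (x + ρ • u) ξ - φhat x ξ) ^ 2 := by
      rw [blockGrad, norm_smul, hu, mul_one, Real.norm_eq_abs, sq_abs, mul_pow]
    simp_rw [e]
    refine ⟨h1.const_mul _, ?_⟩
    rw [integral_const_mul]
    calc (n / ρ) ^ 2 * ∫ ξ, (φhat (x + ρ • u) ξ - φhat x ξ) ^ 2 ∂P
        ≤ (n / ρ) ^ 2 * (ρ ^ 2 * C) := by gcongr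
      _ = n ^ 2 * C := by field_simp
  have hm2 : AEStronglyMeasurable (fun p => ‖blockGrad φhat ρ x p‖ ^ 2)
      (P.prod (sphereUniform n)) := hm.norm.pow 2
  have hI : Integrable (fun p => ‖blockGrad φhat ρ x p‖ ^ 2) (P.prod (sphereUniform n)) := by
    refine (integrable_prod_iff' hm2).2 ⟨hsec.mono fun u hu => hu.1, ?_⟩
    refine (integrable_const (n ^ 2 * C)).mono' hm2.norm.prod_swap.integral_prod_right' ?_
    filter_upwards [hsec] with u hu
    rw [Real.norm_of_nonneg (integral_nonneg fun _ => norm_nonneg _)]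
    simpa using hu.2
  refine ⟨(memLp_two_iff_integrable_sq_norm hm).2 hI, ?_⟩
  rw [integral_prod_symm _ hI]
  calc ∫ u, ∫ ξ, ‖blockGrad φhat ρ x (ξ, u)‖ ^ 2 ∂P ∂sphereUniform n
      ≤ ∫ _, n ^ 2 * C ∂sphereUniform n :=
        integral_mono_ae hI.integral_prod_right (integrable_const _) (hsec.mono fun u hu => hu.2)
    _ = n ^ 2 * C := by simp

/-- The bias of the one-sided estimate: the linear part of `φ` is reproduced exactly, as
`𝔼[⟪a, u⟫ u] = a / n`, and the remainder is at most `ℓ ρ²`. -/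
lemma norm_integral_blockGrad_sub_le [IsProbabilityMeasure P]
    (h : IsNoisyFunction P φ φhat x ℓ M σ) (hn : 1 ≤ n) (hℓ : 0 ≤ ℓ) (hρ : 0 < ρ) (hρ1 : ρ ≤ 1) :
    ‖∫ p, blockGrad φhat ρ x p ∂(P.prod (sphereUniform n)) - gradient φ x‖ ≤ n * ℓ * ρ := by
  have := isProbabilityMeasure_sphereUniform hn
  have hn' : (0 : ℝ) < n := by exact_mod_cast hn
  have hI := (h.memLp_blockGrad hn hℓ hρ hρ1).1.integrable (by norm_num)
  rw [integral_prod_symm _ hI]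
  have e1 : ∀ᵐ u ∂sphereUniform n, ∫ ξ, blockGrad φhat ρ x (ξ, u) ∂P =
      (n / ρ * (φ (x + ρ • u) - φ x)) • u := by
    filter_upwards [ae_norm_eq_one_sphereUniform] with u hu
    have h1 := h.mean _ (add_smul_mem_closedBall x hu hρ.le hρ1)
    have h2 := h.mean x (Metric.mem_closedBall_self zero_le_one)
    simp only [blockGrad]
    rw [integral_smul_const, integral_const_mul, integral_sub h1.1 h2.1, h1.2, h2.2]
  have i1 := hI.integral_prod_right.congr e1
  have i2 : Integrable (fun u : EuclideanSpace ℝ (Fin n) =>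
      (n : ℝ) • (inner ℝ (gradient φ x) u : ℝ) • u) (sphereUniform n) := by
    refine integrable_of_bound_on_sphere (by fun_prop) (n * ‖gradient φ x‖) fun u hu => ?_
    have := abs_real_inner_le_norm (gradient φ x) u
    rw [norm_smul, norm_smul, hu, mul_one, Real.norm_natCast, Real.norm_eq_abs]
    rw [hu, mul_one] at this
    gcongr
  have e2 : gradient φ x =
      ∫ u, (n : ℝ) • (inner ℝ (gradient φ x) u : ℝ) • u ∂sphereUniform n := by
    rw [integral_smul, integral_inner_smul_sphereUniform hn, smul_smul, mul_one_div_cancel hn'.ne',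
      one_smul]
  rw [integral_congr_ae e1]
  nth_rw 1 [e2]
  rw [← integral_sub i1 i2]
  have hb : ∀ᵐ u ∂sphereUniform n, ‖(n / ρ * (φ (x + ρ • u) - φ x)) • u -
      (n : ℝ) • (inner ℝ (gradient φ x) u : ℝ) • u‖ ≤ n * ℓ * ρ := by
    filter_upwards [ae_norm_eq_one_sphereUniform] with u hu
    have hsub : segment ℝ x (x + ρ • u) ⊆ Metric.closedBall x 1 :=
      (convex_closedBall x 1).segment_subset (Metric.mem_closedBall_self zero_le_one)
        (add_smul_mem_closedBall x hu hρ.le hρ1)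
    have hρu : ‖x + ρ • u - x‖ = ρ := by
      rw [add_sub_cancel_left, norm_smul, hu, mul_one, Real.norm_of_nonneg hρ.le]
    have h1 := Convex.norm_image_sub_le_of_norm_hasFDerivWithin_le'
      (s := segment ℝ x (x + ρ • u)) (f := φ) (C := ℓ * ρ)
      (φ := InnerProductSpace.toDual ℝ _ (gradient φ x))
      (fun p hp => (h.differentiable p (hsub hp)).hasGradientAt.hasFDerivAt.hasFDerivWithinAt)
      (fun p hp => by
        rw [← map_sub, LinearIsometryEquiv.norm_map]
        refine (h.lipschitz p (hsub hp)).trans ?_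
        have h2 := norm_sub_le_of_mem_segment hp
        rw [hρu] at h2
        gcongr)
      (convex_segment _ _) (left_mem_segment ℝ _ _) (right_mem_segment ℝ _ _)
    rw [hρu, add_sub_cancel_left, InnerProductSpace.toDual_apply_apply, inner_smul_right] at h1
    have e3 : (n / ρ * (φ (x + ρ • u) - φ x)) • u - (n : ℝ) • (inner ℝ (gradient φ x) u : ℝ) • u =
        (n / ρ * (φ (x + ρ • u) - φ x - ρ * inner ℝ (gradient φ x) u)) • u := by
      rw [smul_smul, ← sub_smul]
      congr 1
      field_simp
    rw [e3, norm_smul, hu, mul_one, norm_mul, Real.norm_of_nonneg (by positivity)]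
    calc n / ρ * ‖φ (x + ρ • u) - φ x - ρ * inner ℝ (gradient φ x) u‖
        ≤ n / ρ * (ℓ * ρ * ρ) := by gcongr
      _ = n * ℓ * ρ := by field_simp
  calc _ ≤ n * ℓ * ρ * (sphereUniform n).real Set.univ := norm_integral_le_of_norm_le_const hb
    _ = n * ℓ * ρ := by simp

end IsNoisyFunction

end OneBlock

/-! ### The operator of the saddle-point problem -/

section Saddle

/-- The first-order condition for strong convexity. Differentiability is needed at `x` only. -/
lemma add_inner_gradient_le_of_strongConvexOn {E : Type*} [NormedAddCommGroup E]
    [InnerProductSpace ℝ E] [CompleteSpace E] {X : Set E} {μ : ℝ} {g : E → ℝ}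
    (hg : StrongConvexOn X μ g) {x x' : E} (hx : x ∈ X) (hx' : x' ∈ X)
    (hd : DifferentiableAt ℝ g x) :
    g x + inner ℝ (gradient g x) (x' - x) + μ / 2 * ‖x - x'‖ ^ 2 ≤ g x' := by
  have h1 : HasDerivAt (fun t : ℝ => g (x + t • (x' - x))) (inner ℝ (gradient g x) (x' - x)) 0 := by
    have h2 : HasDerivAt (fun t : ℝ => x + t • (x' - x)) (x' - x) 0 := by
      simpa using ((hasDerivAt_id (0 : ℝ)).smul_const (x' - x)).const_add x
    have h3 : HasFDerivAt g (InnerProductSpace.toDual ℝ E (gradient g x))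
        (x + (0 : ℝ) • (x' - x)) := by
      simpa using hd.hasGradientAt.hasFDerivAt
    have h4 := h3.comp_hasDerivAt 0 h2
    rw [InnerProductSpace.toDual_apply_apply] at h4
    exact h4
  have h5 := h1.tendsto_slope_zero_right
  have h6 : Filter.Tendsto (fun t : ℝ => g x' - g x - (1 - t) * (μ / 2 * ‖x - x'‖ ^ 2))
      (nhdsWithin 0 (Set.Ioi 0)) (nhds (g x' - g x - (1 - 0) * (μ / 2 * ‖x - x'‖ ^ 2))) :=
    ((by fun_prop : Continuous fun t : ℝ =>
      g x' - g x - (1 - t) * (μ / 2 * ‖x - x'‖ ^ 2)).tendsto 0).mono_left nhdsWithin_le_nhds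
  have h7 := le_of_tendsto_of_tendsto h5 h6 (by
    filter_upwards [Ioo_mem_nhdsGT (zero_lt_one' ℝ)] with t ht
    have h8 := hg.2 hx hx' (by linarith [ht.2] : 0 ≤ 1 - t) ht.1.le (by ring)
    have e : (1 - t) • x + t • x' = x + t • (x' - x) := by module
    simp only [e, smul_eq_mul] at h8
    simp only [zero_add, zero_smul, add_zero, smul_eq_mul]
    rw [inv_mul_le_iff₀ ht.1]
    linarith)
  linarith

variable {n m : ℕ} {X : Set (EuclideanSpace ℝ (Fin n))} {Y : Set (EuclideanSpace ℝ (Fin m))}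
  {f : EuclideanSpace ℝ (Fin n) → EuclideanSpace ℝ (Fin m) → ℝ} {μ Lx Ly Lxy M L : ℝ}

lemma add_inner_gradient_le_of_strongConcaveOn {E : Type*} [NormedAddCommGroup E]
    [InnerProductSpace ℝ E] [CompleteSpace E] {X : Set E} {μ : ℝ} {g : E → ℝ}
    (hg : StrongConcaveOn X μ g) {x x' : E} (hx : x ∈ X) (hx' : x' ∈ X)
    (hd : DifferentiableAt ℝ g x) :
    g x' ≤ g x + inner ℝ (gradient g x) (x' - x) - μ / 2 * ‖x - x'‖ ^ 2 := by
  have h := add_inner_gradient_le_of_strongConvexOn hg.neg hx hx' hd.neg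
  have e : gradient (-g) x = -gradient g x := by
    rw [gradient, fderiv_neg, map_neg]; rfl
  rw [e, inner_neg_left] at h
  simp only [Pi.neg_apply] at h
  linarith

lemma mem_cthickening_one {E : Type*} [PseudoMetricSpace E] {S : Set E} {x : E} (hx : x ∈ S) :
    x ∈ Metric.cthickening 1 S :=
  Metric.self_subset_cthickening S hx

namespace IsSaddleProblem

lemma isClosed_feasible (h : IsSaddleProblem X Y f μ Lx Ly Lxy M) : IsClosed (feasible X Y) :=
  (h.closed_X.preimage (WithLp.prod_continuous_ofLp 2 _ _).fst).inter
    (h.closed_Y.preimage (WithLp.prod_continuous_ofLp 2 _ _).snd)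

lemma convex_feasible (h : IsSaddleProblem X Y f μ Lx Ly Lxy M) : Convex ℝ (feasible X Y) :=
  fun _ hz _ hw _ _ ha hb hab =>
    ⟨h.convex_X hz.1 hw.1 ha hb hab, h.convex_Y hz.2 hw.2 ha hb hab⟩

/-- Adding the first-order conditions of `f(·, y)`, `f(·, y')`, `-f(x, ·)`, `-f(x', ·)` cancels
all values of `f`. -/
lemma strongMono_saddleMap (h : IsSaddleProblem X Y f μ Lx Ly Lxy M) :
    ∀ z ∈ feasible X Y, ∀ z' ∈ feasible X Y,
      μ * ‖z - z'‖ ^ 2 ≤ inner ℝ (saddleMap f z - saddleMap f z') (z - z') := by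
  rintro z ⟨hx, hy⟩ z' ⟨hx', hy'⟩
  have h1 := add_inner_gradient_le_of_strongConvexOn (h.strongConvex _ hy) hx hx'
    (h.differentiable_x _ (mem_cthickening_one hx) _ hy)
  have h2 := add_inner_gradient_le_of_strongConvexOn (h.strongConvex _ hy') hx' hx
    (h.differentiable_x _ (mem_cthickening_one hx') _ hy')
  have h3 := add_inner_gradient_le_of_strongConcaveOn (h.strongConcave _ hx) hy hy'
    (h.differentiable_y _ hx _ (mem_cthickening_one hy))
  have h4 := add_inner_gradient_le_of_strongConcaveOn (h.strongConcave _ hx') hy' hy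
    (h.differentiable_y _ hx' _ (mem_cthickening_one hy'))
  rw [WithLp.prod_inner_apply, WithLp.prod_norm_sq_eq_of_L2]
  change _ ≤ inner ℝ (gradient (fun x => f x z.snd) z.fst - gradient (fun x => f x z'.snd) z'.fst)
      (z.fst - z'.fst) +
    inner ℝ (-gradient (fun y => f z.fst y) z.snd - -gradient (fun y => f z'.fst y) z'.snd)
      (z.snd - z'.snd)
  simp only [WithLp.sub_fst, WithLp.sub_snd]
  rw [norm_sub_rev z'.fst] at h2
  rw [norm_sub_rev z'.snd] at h4
  simp only [inner_sub_left, inner_sub_right, inner_neg_left] at h1 h2 h3 h4 ⊢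
  linarith

/-- Each partial gradient is Lipschitz with constant `L / 2` in each of the two variables; the
factor `2` in `L` pays for adding up the four contributions. -/
lemma lipschitz_saddleMap (h : IsSaddleProblem X Y f μ Lx Ly Lxy M)
    (hL : L = 2 * max Lx (max Ly Lxy)) :
    ∀ z ∈ feasible X Y, ∀ z' ∈ feasible X Y, ‖saddleMap f z - saddleMap f z'‖ ≤ L * ‖z - z'‖ := by
  rintro z ⟨hx, hy⟩ z' ⟨hx', hy'⟩
  have hLx : Lx ≤ L / 2 := by rw [hL]; linarith [le_max_left Lx (max Ly Lxy)]
  have hLy : Ly ≤ L / 2 := by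
    rw [hL]; linarith [(le_max_left Ly Lxy).trans (le_max_right Lx (max Ly Lxy))]
  have hLxy : Lxy ≤ L / 2 := by
    rw [hL]; linarith [(le_max_right Ly Lxy).trans (le_max_right Lx (max Ly Lxy))]
  set a := ‖z.fst - z'.fst‖
  set b := ‖z.snd - z'.snd‖
  have ha : 0 ≤ a := norm_nonneg _
  have hb : 0 ≤ b := norm_nonneg _
  have h1 : ‖gradX f z.fst z.snd - gradX f z'.fst z'.snd‖ ≤ L / 2 * (a + b) := by
    have h1 := h.lipschitz_xx _ hy _ (mem_cthickening_one hx) _ (mem_cthickening_one hx')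
    have h2 := h.lipschitz_xy _ hx' _ hy _ hy'
    have h3 := norm_sub_le_norm_sub_add_norm_sub (gradX f z.fst z.snd) (gradX f z'.fst z.snd)
      (gradX f z'.fst z'.snd)
    nlinarith
  have h2 : ‖gradY f z.fst z.snd - gradY f z'.fst z'.snd‖ ≤ L / 2 * (a + b) := by
    have h1 := h.lipschitz_yy _ hx _ (mem_cthickening_one hy) _ (mem_cthickening_one hy')
    have h2 := h.lipschitz_yx _ hy' _ hx _ hx'
    have h3 := norm_sub_le_norm_sub_add_norm_sub (gradY f z.fst z.snd) (gradY f z.fst z'.snd)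
      (gradY f z'.fst z'.snd)
    nlinarith
  by_cases hL0 : 0 ≤ L
  · refine le_of_sq_le_sq ?_ (by positivity)
    rw [mul_pow, WithLp.prod_norm_sq_eq_of_L2, WithLp.prod_norm_sq_eq_of_L2 (z - z')]
    have e1 : (saddleMap f z - saddleMap f z').fst =
        gradX f z.fst z.snd - gradX f z'.fst z'.snd := rfl
    have e2 : (saddleMap f z - saddleMap f z').snd =
        -(gradY f z.fst z.snd - gradY f z'.fst z'.snd) := by
      rw [neg_sub]; simp [saddleMap]; abel
    rw [e1, e2, norm_neg]
    calc _ ≤ (L / 2 * (a + b)) ^ 2 + (L / 2 * (a + b)) ^ 2 := by gcongr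
      _ = L ^ 2 / 2 * (a + b) ^ 2 := by ring
      _ ≤ L ^ 2 / 2 * (2 * (a ^ 2 + b ^ 2)) := by
          gcongr
          nlinarith [sq_nonneg (a - b)]
      _ = L ^ 2 * (a ^ 2 + b ^ 2) := by ring
  -- for negative `L` the Lipschitz bounds leave a single point
  · have hab : a + b = 0 := by
      have := (norm_nonneg _).trans h1
      nlinarith
    have hz : z = z' := by
      have e1 : z.fst = z'.fst := by
        rw [← sub_eq_zero, ← norm_eq_zero]; change a = 0; linarith
      have e2 : z.snd = z'.snd := by
        rw [← sub_eq_zero, ← norm_eq_zero]; change b = 0; linarith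
      exact (WithLp.ofLp_injective 2) (Prod.ext e1 e2)
    simp [hz]

variable {Ξ : Type*} [MeasurableSpace Ξ] {P : Measure Ξ}
  {fhat : EuclideanSpace ℝ (Fin n) → EuclideanSpace ℝ (Fin m) → Ξ → ℝ} {σ : ℝ}

lemma isNoisyFunction_fst (h : IsSaddleProblem X Y f μ Lx Ly Lxy M)
    (ho : IsOracle P X Y f fhat σ) (hL : L = 2 * max Lx (max Ly Lxy)) {z : Joint n m}
    (hz : z ∈ feasible X Y) :
    IsNoisyFunction P (fun x => f x z.snd) (fun x ξ => fhat x z.snd ξ) z.fst (L / 2) M σ := by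
  have hsub := Metric.closedBall_subset_cthickening hz.1 1
  refine ⟨fun p hp => h.differentiable_x p (hsub hp) _ hz.2, fun p hp => ?_,
    h.bound_x _ hz.1 _ hz.2, ?_, fun ξ p hp => ho.differentiable_x ξ p (hsub hp) _ hz.2,
    fun p hp => ho.mean_x p (hsub hp) _ hz.2,
    fun p hp => (ho.mean_gradX p (hsub hp) _ hz.2).1.1,
    fun p hp => ho.variance_gradX p (hsub hp) _ hz.2⟩
  · refine (h.lipschitz_xx _ hz.2 p (hsub hp) _ (mem_cthickening_one hz.1)).trans ?_
    gcongr
    rw [hL]; linarith [le_max_left Lx (max Ly Lxy)]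
  · exact ho.measurable.comp
      ((measurable_fst.prodMk measurable_const).prodMk measurable_snd)

lemma isNoisyFunction_snd (h : IsSaddleProblem X Y f μ Lx Ly Lxy M)
    (ho : IsOracle P X Y f fhat σ) (hL : L = 2 * max Lx (max Ly Lxy)) {z : Joint n m}
    (hz : z ∈ feasible X Y) :
    IsNoisyFunction P (fun y => f z.fst y) (fun y ξ => fhat z.fst y ξ) z.snd (L / 2) M σ := by
  have hsub := Metric.closedBall_subset_cthickening hz.2 1
  refine ⟨fun p hp => h.differentiable_y _ hz.1 p (hsub hp), fun p hp => ?_,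
    h.bound_y _ hz.1 _ hz.2, ?_, fun ξ p hp => ho.differentiable_y ξ _ hz.1 p (hsub hp),
    fun p hp => ho.mean_y _ hz.1 p (hsub hp),
    fun p hp => (ho.mean_gradY _ hz.1 p (hsub hp)).1.1,
    fun p hp => ho.variance_gradY _ hz.1 p (hsub hp)⟩
  · refine (h.lipschitz_yy _ hz.1 p (hsub hp) _ (mem_cthickening_one hz.2)).trans ?_
    gcongr
    rw [hL]; linarith [(le_max_left Ly Lxy).trans (le_max_right Lx (max Ly Lxy))]
  · exact ho.measurable.comp
      ((measurable_const.prodMk measurable_fst).prodMk measurable_snd)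

end IsSaddleProblem

lemma measurable_szGrad {Ξ : Type*} [MeasurableSpace Ξ]
    {fhat : EuclideanSpace ℝ (Fin n) → EuclideanSpace ℝ (Fin m) → Ξ → ℝ}
    (hf : Measurable (fun p : (EuclideanSpace ℝ (Fin n) × EuclideanSpace ℝ (Fin m)) × Ξ =>
      fhat p.1.1 p.1.2 p.2)) (ρx ρy : ℝ) :
    Measurable (Function.uncurry (szGrad fhat ρx ρy)) := by
  have hx : Measurable fun p : Joint n m × Sample Ξ n m => p.1.fst :=
    (WithLp.prod_continuous_ofLp 2 _ _).fst.measurable.comp measurable_fst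
  have hy : Measurable fun p : Joint n m × Sample Ξ n m => p.1.snd :=
    (WithLp.prod_continuous_ofLp 2 _ _).snd.measurable.comp measurable_fst
  have hξ : Measurable fun p : Joint n m × Sample Ξ n m => p.2.1 :=
    measurable_fst.comp measurable_snd
  have hu : Measurable fun p : Joint n m × Sample Ξ n m => p.2.2.1 :=
    measurable_fst.comp (measurable_snd.comp measurable_snd)
  have hv : Measurable fun p : Joint n m × Sample Ξ n m => p.2.2.2 :=
    measurable_snd.comp (measurable_snd.comp measurable_snd)
  have h0 := hf.comp ((hx.prodMk hy).prodMk hξ)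
  have h1 := hf.comp (((hx.add (hu.const_smul ρx)).prodMk hy).prodMk hξ)
  have h2 := hf.comp ((hx.prodMk (hy.add (hv.const_smul ρy))).prodMk hξ)
  exact (WithLp.measurable_toLp 2 _).comp
    ((((h1.sub h0).const_mul (n / ρx)).smul hu).prodMk
      ((((h2.sub h0).const_mul (m / ρy)).smul hv).neg))

/-- The zeroth-order gradient samples the operator of the saddle-point problem, with a second
moment that does not depend on the smoothing radii and a bias proportional to them. -/
theorem isSampledVI_szGrad {Ξ : Type*} [MeasurableSpace Ξ] {P : Measure Ξ} [IsProbabilityMeasure P]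
    {fhat : EuclideanSpace ℝ (Fin n) → EuclideanSpace ℝ (Fin m) → Ξ → ℝ} {σ ρx ρy B : ℝ}
    (hn : 1 ≤ n) (hm : 1 ≤ m) (h : IsSaddleProblem X Y f μ Lx Ly Lxy M)
    (ho : IsOracle P X Y f fhat σ) (hL : L = 2 * max Lx (max Ly Lxy)) (hL0 : 0 ≤ L)
    (hρx : 0 < ρx) (hρx1 : ρx ≤ 1) (hρy : 0 < ρy) (hρy1 : ρy ≤ 1) (hB : 0 ≤ B)
    (hbias : (n * (L / 2) * ρx) ^ 2 + (m * (L / 2) * ρy) ^ 2 ≤ B ^ 2) :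
    IsSampledVI (P.prod ((sphereUniform n).prod (sphereUniform m))) (feasible X Y) (saddleMap f)
      (szGrad fhat ρx ρy) μ L ((n ^ 2 + m ^ 2) * (2 * σ ^ 2 + 2 * (M + L / 2) ^ 2)) B := by
  have := isProbabilityMeasure_sphereUniform hn
  have := isProbabilityMeasure_sphereUniform hm
  set Q := P.prod ((sphereUniform n).prod (sphereUniform m)) with hQ
  have p1 : MeasurePreserving (Prod.map id Prod.fst) Q (P.prod (sphereUniform n)) :=
    (MeasurePreserving.id P).prod measurePreserving_fst
  have p2 : MeasurePreserving (Prod.map id Prod.snd) Q (P.prod (sphereUniform m)) :=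
    (MeasurePreserving.id P).prod measurePreserving_snd
  have hL2 : 0 ≤ L / 2 := by linarith
  have hmeas := measurable_szGrad ho.measurable ρx ρy
  have hpart z (hz : z ∈ feasible X Y) :
      MemLp (szGrad fhat ρx ρy z) 2 Q ∧
      ∫ s, ‖szGrad fhat ρx ρy z s‖ ^ 2 ∂Q ≤
        (n ^ 2 + m ^ 2) * (2 * σ ^ 2 + 2 * (M + L / 2) ^ 2) ∧
      ‖∫ s, szGrad fhat ρx ρy z s ∂Q - saddleMap f z‖ ≤ B := by
    have nx := h.isNoisyFunction_fst ho hL hz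
    have ny := h.isNoisyFunction_snd ho hL hz
    obtain ⟨mx, vx⟩ := nx.memLp_blockGrad hn hL2 hρx hρx1
    obtain ⟨my, vy⟩ := ny.memLp_blockGrad hm hL2 hρy hρy1
    have bx := nx.norm_integral_blockGrad_sub_le hn hL2 hρx hρx1
    have hby := ny.norm_integral_blockGrad_sub_le hm hL2 hρy hρy1
    set gx := blockGrad (fun x ξ => fhat x z.snd ξ) ρx z.fst with hgx
    set gy := blockGrad (fun y ξ => fhat z.fst y ξ) ρy z.snd with hgy
    have ex s : (szGrad fhat ρx ρy z s).fst = gx (Prod.map id Prod.fst s) := rfl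
    have ey s : (szGrad fhat ρx ρy z s).snd = -gy (Prod.map id Prod.snd s) := rfl
    have mx' := mx.comp_measurePreserving p1
    have my' := my.comp_measurePreserving p2
    have ix : ∫ s, gx (Prod.map id Prod.fst s) ∂Q = ∫ p, gx p ∂(P.prod (sphereUniform n)) := by
      rw [← p1.map_eq, integral_map p1.aemeasurable (by rw [p1.map_eq]; exact mx.1)]
    have iy : ∫ s, gy (Prod.map id Prod.snd s) ∂Q = ∫ p, gy p ∂(P.prod (sphereUniform m)) := by
      rw [← p2.map_eq, integral_map p2.aemeasurable (by rw [p2.map_eq]; exact my.1)]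
    have ix2 : ∫ s, ‖gx (Prod.map id Prod.fst s)‖ ^ 2 ∂Q =
        ∫ p, ‖gx p‖ ^ 2 ∂(P.prod (sphereUniform n)) := by
      rw [← p1.map_eq, integral_map p1.aemeasurable (by rw [p1.map_eq]; exact mx.1.norm.pow 2)]
    have iy2 : ∫ s, ‖gy (Prod.map id Prod.snd s)‖ ^ 2 ∂Q =
        ∫ p, ‖gy p‖ ^ 2 ∂(P.prod (sphereUniform m)) := by
      rw [← p2.map_eq, integral_map p2.aemeasurable (by rw [p2.map_eq]; exact my.1.norm.pow 2)]
    have e s : ‖szGrad fhat ρx ρy z s‖ ^ 2 = ‖gx (Prod.map id Prod.fst s)‖ ^ 2 +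
        ‖gy (Prod.map id Prod.snd s)‖ ^ 2 := by
      rw [WithLp.prod_norm_sq_eq_of_L2, ex, ey, norm_neg]
    have jx := integrable_norm_sq_of_memLp mx'
    have jy := integrable_norm_sq_of_memLp my'
    simp only [Function.comp_apply] at jx jy
    have hmem : MemLp (szGrad fhat ρx ρy z) 2 Q := by
      refine (memLp_two_iff_integrable_sq_norm
        (hmeas.comp measurable_prodMk_left).aestronglyMeasurable).2 ?_
      simp only [Function.comp_def, Function.uncurry_apply_pair, e]
      exact jx.add jy
    refine ⟨hmem, ?_, ?_⟩
    · simp_rw [e]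
      rw [integral_add jx jy, ix2, iy2, add_mul]
      exact add_le_add vx vy
    · have hint := hmem.integrable (by norm_num)
      have fx : (∫ s, szGrad fhat ρx ρy z s ∂Q).fst = ∫ p, gx p ∂(P.prod (sphereUniform n)) := by
        rw [← ix]
        exact ((WithLp.fstL 2 ℝ _ _).integral_comp_comm hint).symm
      have fy : (∫ s, szGrad fhat ρx ρy z s ∂Q).snd = -∫ p, gy p ∂(P.prod (sphereUniform m)) := by
        rw [← iy, ← integral_neg]
        exact ((WithLp.sndL 2 ℝ _ _).integral_comp_comm hint).symm
      refine le_of_sq_le_sq ?_ hB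
      refine le_trans ?_ hbias
      rw [WithLp.prod_norm_sq_eq_of_L2]
      have gx' : (∫ s, szGrad fhat ρx ρy z s ∂Q - saddleMap f z).fst =
          ∫ p, gx p ∂(P.prod (sphereUniform n)) - gradient (fun x => f x z.snd) z.fst := by
        rw [← fx]; rfl
      have gy' : (∫ s, szGrad fhat ρx ρy z s ∂Q - saddleMap f z).snd =
          -(∫ p, gy p ∂(P.prod (sphereUniform m)) - gradient (fun y => f z.fst y) z.snd) := by
        rw [neg_sub', ← fy]; rfl
      rw [gx', gy', norm_neg]
      gcongr
  exact ⟨h.isClosed_feasible, h.convex_feasible, h.strongMono_saddleMap,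
    h.lipschitz_saddleMap hL, hmeas, fun z hz => (hpart z hz).1, fun z hz => (hpart z hz).2.1,
    fun z hz => (hpart z hz).2.2⟩

end Saddle

/-! ### Iteration count, batch sizes and smoothing radii -/

section Parameters

variable {κ : ℝ}

lemma inv_rate_eq (hκ : 1 ≤ κ) : (rate κ)⁻¹ = 1 + 1 / (8 * κ) := by
  rw [rate_eq hκ]; field_simp

lemma one_div_le_log_inv_rate (hκ : 1 ≤ κ) : 1 / (9 * κ) ≤ Real.log (rate κ)⁻¹ := by
  have h1 := Real.one_sub_inv_le_log_of_pos (inv_pos.2 (rate_pos hκ))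
  rw [inv_inv] at h1
  refine le_trans ?_ h1
  rw [rate, sub_sub_cancel]
  gcongr
  linarith

/-- The number of iterations that reduces the initial error by the factor `C / ε`. It has to be
exact up to an additive constant, as the last batch size is of the order `K q⁻ᴷ`: a number larger
by a constant factor would worsen the power of `1 / ε` in the sample count. -/
def iterCount (κ C ε : ℝ) : ℕ := ⌈Real.log (C / ε) / Real.log (rate κ)⁻¹⌉₊

variable {C ε : ℝ}

lemma half_le_log_one_div (hε : 0 < ε) (hε2 : ε ≤ 1 / 2) : 1 / 2 ≤ Real.log (1 / ε) := by
  have h1 : Real.log 2 ≤ Real.log (1 / ε) :=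
    Real.log_le_log (by norm_num) (by rw [le_div_iff₀ hε]; linarith)
  linarith [Real.log_two_gt_d9]

lemma log_div_pos (hC : 1 ≤ C) (hε : 0 < ε) (hε2 : ε ≤ 1 / 2) : 0 < Real.log (C / ε) :=
  Real.log_pos (by rw [lt_div_iff₀ hε]; linarith)

lemma iterCount_pos (hκ : 1 ≤ κ) (hC : 1 ≤ C) (hε : 0 < ε) (hε2 : ε ≤ 1 / 2) :
    0 < iterCount κ C ε := by
  have h1 := one_div_le_log_inv_rate hκ
  have h2 : 0 < 1 / (9 * κ) := by positivity
  exact Nat.ceil_pos.2 (div_pos (log_div_pos hC hε hε2) (h2.trans_le h1))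

lemma rate_pow_iterCount_le (hκ : 1 ≤ κ) (hC : 1 ≤ C) (hε : 0 < ε) :
    rate κ ^ iterCount κ C ε ≤ ε / C := by
  have hq := rate_pos hκ
  have h1 := one_div_le_log_inv_rate hκ
  have h2 : 0 < Real.log (rate κ)⁻¹ := lt_of_lt_of_le (by positivity) h1
  have h3 := (div_le_iff₀ h2).1 (Nat.le_ceil (Real.log (C / ε) / Real.log (rate κ)⁻¹))
  rw [← Real.log_pow] at h3
  have h4 := (Real.log_le_log_iff (by positivity) (by positivity)).1 h3
  rw [inv_pow] at h4
  rw [← inv_div]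
  exact (le_inv_comm₀ (by positivity) (by positivity)).1 h4

lemma iterCount_lt (hκ : 1 ≤ κ) (hC : 1 ≤ C) (hε : 0 < ε) (hε2 : ε ≤ 1 / 2) :
    (iterCount κ C ε : ℝ) < Real.log (C / ε) / Real.log (rate κ)⁻¹ + 1 := by
  have h1 := one_div_le_log_inv_rate hκ
  have h2 : 0 < Real.log (rate κ)⁻¹ := lt_of_lt_of_le (by positivity) h1
  exact Nat.ceil_lt_add_one (div_nonneg (log_div_pos hC hε hε2).le h2.le)

/-- Rounding up costs one factor `(rate κ)⁻¹ ≤ 9 / 8`. -/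
lemma inv_rate_pow_iterCount_le (hκ : 1 ≤ κ) (hC : 1 ≤ C) (hε : 0 < ε) (hε2 : ε ≤ 1 / 2) :
    (rate κ)⁻¹ ^ iterCount κ C ε ≤ 9 / 8 * (C / ε) := by
  have hq := rate_pos hκ
  have h1 := one_div_le_log_inv_rate hκ
  have h2 : 0 < Real.log (rate κ)⁻¹ := lt_of_lt_of_le (by positivity) h1
  have h3 : iterCount κ C ε * Real.log (rate κ)⁻¹ ≤
      Real.log (rate κ)⁻¹ + Real.log (C / ε) := by
    calc iterCount κ C ε * Real.log (rate κ)⁻¹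
        ≤ (Real.log (C / ε) / Real.log (rate κ)⁻¹ + 1) * Real.log (rate κ)⁻¹ := by
          gcongr; exact (iterCount_lt hκ hC hε hε2).le
      _ = _ := by rw [add_mul, div_mul_cancel₀ _ h2.ne', one_mul, add_comm]
  rw [← Real.log_pow, ← Real.log_mul (by positivity) (by positivity)] at h3
  refine ((Real.log_le_log_iff (by positivity) (by positivity)).1 h3).trans ?_
  gcongr
  rw [inv_le_comm₀ hq (by norm_num)]
  linarith [le_rate hκ]

lemma iterCount_le (hκ : 1 ≤ κ) (hC : 1 ≤ C) (hε : 0 < ε) (hε2 : ε ≤ 1 / 2) :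
    (iterCount κ C ε : ℝ) ≤ (18 * Real.log C + 11) * (κ * Real.log (1 / ε)) := by
  have hl := half_le_log_one_div hε hε2
  have hlC := Real.log_nonneg hC
  have h1 := one_div_le_log_inv_rate hκ
  have h2 : Real.log (C / ε) / Real.log (rate κ)⁻¹ ≤ 9 * κ * Real.log (C / ε) := by
    calc Real.log (C / ε) / Real.log (rate κ)⁻¹ ≤ Real.log (C / ε) / (1 / (9 * κ)) := by
          gcongr
          exact (log_div_pos hC hε hε2).le
      _ = _ := by field_simp
  have h3 : Real.log (C / ε) = Real.log C + Real.log (1 / ε) := by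
    rw [← Real.log_mul (by positivity) (by positivity), mul_one_div]
  rw [h3] at h2
  have h4 : Real.log C * κ ≤ 2 * Real.log C * (κ * Real.log (1 / ε)) := by
    have : 0 ≤ Real.log C * κ := by positivity
    nlinarith
  have h5 : 1 ≤ 2 * (κ * Real.log (1 / ε)) := by nlinarith
  have h6 := (iterCount_lt hκ hC hε hε2).le
  rw [h3] at h6
  linarith

lemma sum_inv_rate_pow_le (hκ : 1 ≤ κ) (K : ℕ) :
    ∑ k ∈ Finset.range K, (rate κ)⁻¹ ^ k ≤ 8 * κ * (rate κ)⁻¹ ^ K := by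
  have h : (rate κ)⁻¹ - 1 = 1 / (8 * κ) := by rw [inv_rate_eq hκ]; ring
  have h0 : 0 < 1 / (8 * κ) := by positivity
  rw [geom_sum_eq (by linarith), h, div_le_iff₀ h0]
  have : 8 * κ * (rate κ)⁻¹ ^ K * (1 / (8 * κ)) = (rate κ)⁻¹ ^ K := by field_simp
  linarith

lemma sum_batchSize_le (hκ : 1 ≤ κ) {K : ℕ} (hK : 0 < K) :
    ((∑ k ∈ Finset.range K, batchSize κ K k : ℕ) : ℝ) ≤ 16 * κ * K * (rate κ)⁻¹ ^ K := by
  have hq := rate_pos hκ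
  have hq1 : 1 ≤ (rate κ)⁻¹ := (one_le_inv₀ hq).2 (rate_lt_one hκ).le
  have hK1 : (1 : ℝ) ≤ K := by exact_mod_cast hK
  have ht : ∀ k ∈ Finset.range K, (batchSize κ K k : ℝ) ≤ 2 * K * (rate κ)⁻¹ ^ k := by
    intro k _
    have h1 : (batchSize κ K k : ℝ) < K * rate κ ^ (-(k : ℤ)) + 1 :=
      Nat.ceil_lt_add_one (by positivity)
    rw [zpow_neg, zpow_natCast, ← inv_pow] at h1
    have h2 : (1 : ℝ) ≤ (rate κ)⁻¹ ^ k := one_le_pow₀ hq1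
    nlinarith
  push_cast
  calc ∑ k ∈ Finset.range K, (batchSize κ K k : ℝ)
      ≤ ∑ k ∈ Finset.range K, 2 * K * (rate κ)⁻¹ ^ k := Finset.sum_le_sum ht
    _ = 2 * K * ∑ k ∈ Finset.range K, (rate κ)⁻¹ ^ k := by rw [Finset.mul_sum]
    _ ≤ 2 * K * (8 * κ * (rate κ)⁻¹ ^ K) := by gcongr; exact sum_inv_rate_pow_le hκ K
    _ = _ := by ring

lemma sum_batchSize_iterCount_le (hκ : 1 ≤ κ) (hC : 1 ≤ C) (hε : 0 < ε) (hε2 : ε ≤ 1 / 2) :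
    ((∑ k ∈ Finset.range (iterCount κ C ε), batchSize κ (iterCount κ C ε) k : ℕ) : ℝ) ≤
      (18 * C * (18 * Real.log C + 11)) * (κ ^ 2 / ε * Real.log (1 / ε)) := by
  have hl := half_le_log_one_div hε hε2
  have hlC := Real.log_nonneg hC
  have hq := rate_pos hκ
  calc _ ≤ 16 * κ * iterCount κ C ε * (rate κ)⁻¹ ^ iterCount κ C ε :=
        sum_batchSize_le hκ (iterCount_pos hκ hC hε hε2)
    _ ≤ 16 * κ * ((18 * Real.log C + 11) * (κ * Real.log (1 / ε))) * (9 / 8 * (C / ε)) := by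
        gcongr
        · exact iterCount_le hκ hC hε hε2
        · exact inv_rate_pow_iterCount_le hκ hC hε hε2
    _ = _ := by ring

lemma rate_rpow_half_sq (hκ : 1 ≤ κ) (K : ℕ) : (rate κ ^ ((K : ℝ) / 2)) ^ 2 = rate κ ^ K := by
  rw [← Real.rpow_natCast, ← Real.rpow_mul (rate_pos hκ).le]
  simp

lemma radius_pos (hκ : 1 ≤ κ) (K : ℕ) {d : ℕ} (hd : 1 ≤ d) : 0 < radius κ K d := by
  have := rate_pos hκ
  have : (0 : ℝ) < d := by exact_mod_cast hd
  unfold radius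
  positivity

lemma radius_le_one (hκ : 1 ≤ κ) (K : ℕ) {d : ℕ} (hd : 1 ≤ d) : radius κ K d ≤ 1 := by
  have hq := rate_pos hκ
  have hd' : (1 : ℝ) ≤ d := by exact_mod_cast hd
  have h1 : rate κ ^ ((K : ℝ) / 2) ≤ 1 :=
    Real.rpow_le_one hq.le (rate_lt_one hκ).le (by positivity)
  have h2 : 1 ≤ √2 * d * κ := by
    have : (1 : ℝ) ≤ √2 := Real.one_le_sqrt.2 (by norm_num)
    exact one_le_mul_of_one_le_of_one_le (one_le_mul_of_one_le_of_one_le this hd') hκ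
  exact mul_le_one₀ (by rw [div_le_one (by positivity)]; exact h2) (by positivity) h1

lemma radius_sq (hκ : 1 ≤ κ) (K : ℕ) {d : ℕ} (hd : 1 ≤ d) (ℓ : ℝ) :
    (d * ℓ * radius κ K d) ^ 2 = ℓ ^ 2 / (2 * κ ^ 2) * rate κ ^ K := by
  have hd' : (0 : ℝ) < d := by exact_mod_cast hd
  rw [radius, mul_pow, mul_pow, mul_pow, rate_rpow_half_sq hκ, div_pow, mul_pow, mul_pow,
    Real.sq_sqrt (by norm_num)]
  field_simp

end Parameters

end SZO

end

theorem proposition4 (n m : ℕ) (hn : 1 ≤ n) (hm : 1 ≤ m) (Lx Ly Lxy M σ R L : ℝ)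
    (hL : L = 2 * max Lx (max Ly Lxy)) :
    ∃ A : ℝ, 0 < A ∧ ∀ μ κ : ℝ, 0 < μ → μ ≤ L → κ = L / μ → ∀ ε : ℝ, 0 < ε → ε ≤ 1 / 2 →
      ∃ K : ℕ, 0 < K ∧
        (K : ℝ) ≤ A * (κ * Real.log (1 / ε)) ∧
        ((∑ k ∈ Finset.range K, SZO.batchSize κ K k : ℕ) : ℝ) ≤
          A * (κ ^ 2 / ε * Real.log (1 / ε)) ∧
        ∀ (X : Set (EuclideanSpace ℝ (Fin n))) (Y : Set (EuclideanSpace ℝ (Fin m)))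
          (f : EuclideanSpace ℝ (Fin n) → EuclideanSpace ℝ (Fin m) → ℝ),
          SZO.IsSaddleProblem X Y f μ Lx Ly Lxy M →
        ∀ (Ξ : Type*) [MeasurableSpace Ξ] (P : MeasureTheory.Measure Ξ)
          [MeasureTheory.IsProbabilityMeasure P]
          (fhat : EuclideanSpace ℝ (Fin n) → EuclideanSpace ℝ (Fin m) → Ξ → ℝ),
          SZO.IsOracle P X Y f fhat σ →
        ∀ (Ω : Type*) [MeasurableSpace Ω] (Pr : MeasureTheory.Measure Ω)
          [MeasureTheory.IsProbabilityMeasure Pr] (w : ℕ → ℕ → Ω → SZO.Sample Ξ n m),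
          SZO.IsSampling P Pr w →
        ∀ z0 zs : SZO.Joint n m, z0 ∈ SZO.feasible X Y →
          SZO.IsVISolution (SZO.feasible X Y) (SZO.saddleMap f) zs →
          ‖z0 - zs‖ ≤ R →
          MeasureTheory.Integrable
            (fun ω => ‖SZO.szoExm X Y fhat L κ K (fun k i => w k i ω) z0 K - zs‖ ^ 2) Pr ∧
          ∫ ω, ‖SZO.szoExm X Y fhat L κ K (fun k i => w k i ω) z0 K - zs‖ ^ 2 ∂Pr ≤ ε := by
  set V : ℝ := (n ^ 2 + m ^ 2) * (2 * σ ^ 2 + 2 * (M + L / 2) ^ 2) with hV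
  set C' : ℝ := 9 / 4 * R ^ 2 + (15 * V + 41 * (L ^ 2 / 4)) / L ^ 2 with hC'
  have hV0 : 0 ≤ V := by positivity
  have hC'0 : 0 ≤ C' := by positivity
  set C : ℝ := 1 + C' with hCdef
  have hC : 1 ≤ C := by linarith
  have hlC := Real.log_nonneg hC
  refine ⟨18 * C * (18 * Real.log C + 11), by positivity, ?_⟩
  intro μ κ hμ hμL hκL ε hε hε2
  have hL0 : 0 < L := hμ.trans_le hμL
  have hκ : 1 ≤ κ := by rw [hκL]; exact (one_le_div hμ).2 hμL
  have hq := SZO.rate_pos hκ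
  have hl := SZO.half_le_log_one_div hε hε2
  have hμκ : μ = L / κ := by rw [hκL]; field_simp
  set K := SZO.iterCount κ C ε with hKdef
  have hK : 0 < K := SZO.iterCount_pos hκ hC hε hε2
  refine ⟨K, hK, ?_, SZO.sum_batchSize_iterCount_le hκ hC hε hε2, ?_⟩
  · refine (SZO.iterCount_le hκ hC hε hε2).trans ?_
    have h1 : 0 ≤ (18 * Real.log C + 11) * (κ * Real.log (1 / ε)) := by positivity
    nlinarith
  intro X Y f hf Ξ _ P _ fhat ho Ω _ Pr _ w hw z0 zs hz0 hzs hR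
  have := SZO.isProbabilityMeasure_sphereUniform hn
  have := SZO.isProbabilityMeasure_sphereUniform hm
  -- the two blocks contribute equally to the squared bias
  have hbias : (n * (L / 2) * SZO.radius κ K n) ^ 2 + (m * (L / 2) * SZO.radius κ K m) ^ 2 ≤
      (L / 2 / κ * SZO.rate κ ^ ((K : ℝ) / 2)) ^ 2 := by
    rw [SZO.radius_sq hκ K hn, SZO.radius_sq hκ K hm, mul_pow, SZO.rate_rpow_half_sq hκ]
    apply le_of_eq
    field_simp
    ring
  have hvi := SZO.isSampledVI_szGrad (B := L / 2 / κ * SZO.rate κ ^ ((K : ℝ) / 2)) hn hm hf ho hL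
    hL0.le (SZO.radius_pos hκ K hn) (SZO.radius_le_one hκ K hn) (SZO.radius_pos hκ K hm)
    (SZO.radius_le_one hκ K hm) (by positivity) hbias
  rw [hμκ] at hvi
  obtain ⟨h1, h2⟩ := SZO.integral_norm_samplePath_sub_sq_le (t := SZO.batchSize κ K)
    (c := L ^ 2 / 4) hL0 hκ hvi hz0 ⟨hw.measurable, hw.law, hw.indep⟩ hK
    (fun k => Nat.le_ceil _) hzs hR
    (by
      rw [mul_pow, SZO.rate_rpow_half_sq hκ]
      apply le_of_eq
      field_simp
      ring) rfl
  refine ⟨h1, h2.trans ?_⟩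
  calc SZO.rate κ ^ K * C' ≤ ε / C * C := by
        gcongr
        · exact SZO.rate_pow_iterCount_le hκ hC hε
        · linarith
    _ = ε := by field_simp
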